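/- Constants come from a fixed countably infinite set. A schema $\mathbf S$ is a finite set of relation symbols with arities; an $\mathbf S$-instance is a finite set of facts $R(a_1,\dots,a_n)$, and its active domain is the set of constants occurring in it. An MMSNP sentence over $\mathbf S$ has the form $\theta=\exists X_1\cdots\exists X_n\forall x_1\cdots\forall x_m\,\varphi$ with $X_1,\dots,X_n$ monadic second-order variables and $\varphi$ a finite conjunction of implications $\beta_1\vee\cdots\vee\beta_p\leftarrow\alpha_1\wedge\cdots\wedge\alpha_q$ ($p,q\ge 0$), where each $\alpha_i$ is of the form $X_j(x)$ or $R(\mathbf x)$ with $R\in\mathbf S$ and each $\beta_i$ is of the form $X_j(x)$; quantifiers range over the active domain, each implication being universally quantified over the variables occurring in it. The diameter of $\theta$ is the maximum number of first-order variables in one of its implications. The sentence $\neg\theta$ is MDLog-rewritable if there is a Boolean monadic Datalog program $\Gamma$ over EDB schema $\mathbf S$ (finitely many rules with non-empty bodies, every head variable occurring in the body, all IDB relations of arity at most one, a nullary relation $\mathsf{goal}$ that does not occur in bodies) such that for every $\mathbf S$-instance $I$, $\Gamma$ derives $\mathsf{goal}()$ on $I$ iff $I\not\models\theta$. An obstruction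 set for $\theta$ is a set $\mathcal O$ of finite or infinite sets of $\mathbf S$-facts such that for every $\mathbf S$-instance $I$, $I\not\models\theta$ iff some $O\in\mathcal O$ has a homomorphism to $I$. A set of facts has treewidth $(\ell,k)$ if it has a tree decomposition (over a finite or infinite tree) in which every bag has at most $k$ elements and any two distinct bags share at most $\ell$ elements. **Proposition.** Let $\theta$ be an MMSNP sentence of diameter $k$ over $\mathbf S$ such that $\theta$ holds in the empty instance and, in case $\mathbf S$ contains a relation symbol of arity greater than $k$, every instance with empty active domain that satisfies $\theta$ is contained in an instance with non-empty active domain that satisfies $\theta$. (Both conditions hold if every implication of $\theta$ has a non-empty body that contains all variables of its head. If all relation symbols have positive arity, the second condition just says that $\theta$ holds in some non-empty instance.) Then the following are equivalent: 1. $\neg\theta$ is MDLog-rewritable; 2. $\theta$ has an obstruction set all of whose members have treewidth $(1,k)$; 3. $\theta$ has an obstruction set all of whose members are finite and have treewidth $(1,k)$. -/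

import Mathlib

namespace MDLogObstruction

/-- A schema: a finite collection of relation symbols with associated arities. -/
structure Schema where
  Sym : Type
  finite_sym : Finite Sym
  arity : Sym → ℕ

/-- An expression `R(t₁, …, tₙ)` with arguments from `α` (constants or variables). -/
structure Atom (S : Schema) (α : Type) where
  sym : S.Sym
  args : Fin (S.arity sym) → α

/-- Apply a map to all arguments of an atom. -/
def Atom.map {S : Schema} {α β : Type} (f : α → β) (a : Atom S α) : Atom S β :=
  ⟨a.sym, fun i => f (a.args i)⟩

/-- The arguments that occur in an atom. -/
def Atom.vars {S : Schema} {α : Type} (a : Atom S α) : Set α := Set.range a.args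

/-- The fixed countably infinite set of constants. -/
abbrev Const : Type := ℕ

/-- A (possibly infinite) set of facts. The instances on which queries are evaluated are the
finite ones; finiteness is stated explicitly where it is required. -/
abbrev FactSet (S : Schema) : Type := Set (Atom S Const)

/-- The active domain: all constants that occur in a fact. -/
def adom {S : Schema} (I : FactSet S) : Set Const := {c | ∃ f ∈ I, c ∈ f.vars}

/-- There is a homomorphism from `I` to `J`. -/
def HomTo {S : Schema} (I J : FactSet S) : Prop :=
  ∃ h : Const → Const, ∀ f ∈ I, f.map h ∈ J

/-! ### Tree decompositions -/

/-- A tree decomposition of a set of facts. -/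
structure TreeDecomposition {S : Schema} (I : FactSet S) where
  V : Type
  T : SimpleGraph V
  isTree : T.IsTree
  bag : V → Set Const
  bag_subset : ∀ v, bag v ⊆ adom I
  connected : ∀ a ∈ adom I, (T.induce {v | a ∈ bag v}).Connected
  covers : ∀ f ∈ I, ∃ v, f.vars ⊆ bag v

/-- `I` has treewidth `(ℓ, k)`: there is a tree decomposition in which any two distinct bags
share at most `ℓ` elements and every bag has at most `k` elements. -/
def HasTreewidth {S : Schema} (l k : ℕ) (I : FactSet S) : Prop :=
  ∃ D : TreeDecomposition I,
    (∀ v w, v ≠ w → (D.bag v ∩ D.bag w).encard ≤ l) ∧ ∀ v, (D.bag v).encard ≤ k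

/-! ### MMSNP sentences -/

/-- An implication `β₁ ∨ ⋯ ∨ βₚ ← α₁ ∧ ⋯ ∧ α_q` over `n` monadic second-order variables and `m`
first-order variables. A pair `(i, j)` stands for the atom `Xᵢ(xⱼ)`. -/
structure Implication (S : Schema) (n m : ℕ) where
  head : List (Fin n × Fin m)
  bodySO : List (Fin n × Fin m)
  bodyEDB : List (Atom S (Fin m))

/-- The first-order variables that occur in an implication. -/
def Implication.vars {S : Schema} {n m : ℕ} (c : Implication S n m) : Set (Fin m) :=
  {x | (∃ p ∈ c.head, p.2 = x) ∨ (∃ p ∈ c.bodySO, p.2 = x) ∨ ∃ a ∈ c.bodyEDB, x ∈ a.vars}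

/-- Truth of an implication under an interpretation of the second-order variables and an
assignment of the first-order variables. -/
def Implication.Sat {S : Schema} {n m : ℕ} (c : Implication S n m) (I : FactSet S)
    (X : Fin n → Set Const) (v : Fin m → Const) : Prop :=
  (∀ p ∈ c.bodySO, v p.2 ∈ X p.1) → (∀ a ∈ c.bodyEDB, a.map v ∈ I) →
    ∃ p ∈ c.head, v p.2 ∈ X p.1

/-- An MMSNP sentence `∃ X₁ ⋯ Xₙ ∀ x₁ ⋯ xₘ φ`, with `φ` a conjunction of implications. -/
structure MMSNP (S : Schema) where
  numSO : ℕ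
  numFO : ℕ
  clauses : List (Implication S numSO numFO)

/-- The diameter: the maximum number of variables in an implication. -/
noncomputable def MMSNP.diameter {S : Schema} (θ : MMSNP S) : ℕ :=
  (θ.clauses.map fun c => c.vars.ncard).foldr max 0

/-- Satisfaction; all quantifiers range over (subsets of) the active domain, and each implication
is universally quantified over the variables that occur in it (so that on an empty active domain
an implication without variables is not vacuously true). -/
def MMSNP.Holds {S : Schema} (θ : MMSNP S) (I : FactSet S) : Prop :=
  ∃ X : Fin θ.numSO → Set Const, (∀ i, X i ⊆ adom I) ∧
    ∀ c ∈ θ.clauses, ∀ v : Fin θ.numFO → Const, (∀ x ∈ c.vars, v x ∈ adom I) → c.Sat I X v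

/-! ### Boolean Datalog programs -/

/-- A Datalog rule of a Boolean program with EDB schema `S` and IDB schema `P` (not containing the
goal relation). The head `none` stands for `goal()`, which cannot occur in bodies. -/
structure DatalogRule (S P : Schema) where
  numVars : ℕ
  head : Option (Atom P (Fin numVars))
  bodyEDB : List (Atom S (Fin numVars))
  bodyIDB : List (Atom P (Fin numVars))
  body_nonempty : bodyEDB ≠ [] ∨ bodyIDB ≠ []
  head_safe : ∀ h ∈ head, ∀ x ∈ h.vars,
    (∃ a ∈ bodyEDB, x ∈ a.vars) ∨ ∃ a ∈ bodyIDB, x ∈ a.vars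

/-- Truth of a rule when the EDB relations are given by `I`, the other IDB relations by `J`, and
the nullary goal relation by `g`. -/
def DatalogRule.Sat {S P : Schema} (r : DatalogRule S P) (I : FactSet S) (J : FactSet P)
    (g : Prop) : Prop :=
  ∀ v : Fin r.numVars → Const,
    (∀ a ∈ r.bodyEDB, a.map v ∈ I) → (∀ a ∈ r.bodyIDB, a.map v ∈ J) →
      match r.head with
      | none => g
      | some h => h.map v ∈ J

/-- A Boolean Datalog program over EDB schema `S`: a finite list of rules. -/
structure DatalogProgram (S : Schema) where
  idb : Schema
  rules : List (DatalogRule S idb)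

/-- The program is monadic: all IDB relations have arity at most one. -/
def DatalogProgram.IsMonadic {S : Schema} (Γ : DatalogProgram S) : Prop :=
  ∀ P, Γ.idb.arity P ≤ 1

/-- `I ⊨ Γ`: every extension of `I` by IDB facts that satisfies all rules contains `goal()`. -/
def DatalogProgram.Holds {S : Schema} (Γ : DatalogProgram S) (I : FactSet S) : Prop :=
  ∀ (J : FactSet Γ.idb) (g : Prop), (∀ r ∈ Γ.rules, r.Sat I J g) → g

/-- `¬θ` is MDLog-rewritable: some Boolean monadic Datalog program is true on exactly those
instances that do not satisfy `θ`. -/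
def MMSNP.NegMDLogRewritable {S : Schema} (θ : MMSNP S) : Prop :=
  ∃ Γ : DatalogProgram S, Γ.IsMonadic ∧
    ∀ I : FactSet S, I.Finite → (Γ.Holds I ↔ ¬ θ.Holds I)

/-! ### Obstructions -/

/-- `Ω` is an obstruction set for `θ`: an instance falsifies `θ` iff some member of `Ω` maps
homomorphically to it. Members of `Ω` may be infinite. -/
def MMSNP.IsObstructionSet {S : Schema} (θ : MMSNP S) (Ω : Set (FactSet S)) : Prop :=
  ∀ I : FactSet S, I.Finite → (¬ θ.Holds I ↔ ∃ O ∈ Ω, HomTo O I)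

end MDLogObstruction

open MDLogObstruction

namespace MDLogObstruction

/-! ### Atoms, active domains and homomorphisms -/

section Basics

variable {S : Schema}

/-! The central tool is a finite notion of type. In a model of `θ` with a fixed witness, the type of
a constant records its color and which colored patterns in the first-order variables of `θ` are
realized with some variables placed at that constant; the rootless patterns form the global type.
Types are fine enough for gluing (`MMSNP.holds_of_blocks`). Let `s` bound the number of body atoms,
and let a fact set be covered by blocks any `s` of which form a hyperforest. If the blocks map into
models of `θ` compatibly with one assignment of types and one global type, then the fact set
satisfies `θ`: the blocks touched by a clause body can be peeled off leaf by leaf until the body is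
realized in a single model.

From finite obstructions to a program: the canonical program has sets of types as IDB relations and
all sound rules with at most `k` variables (plus rules that derive trivial facts). If it does not
derive the goal on a set of treewidth `(1, k)`, each bag has a countermodel in which the type of one
of its constants can be prescribed. Distinct bags share at most one constant, so these local choices
fit together along the tree, and gluing makes `θ` true (`canonicalProgram_complete`).

From infinite to finite obstructions: a model of `θ` of treewidth `(1, k)` folds onto finitely many
bag descriptions. Repeated voltage covers make this finite system locally a hyperforest, so gluing
gives a finite model to which the original maps (`MMSNP.exists_finite_folding`). Hence even infinite
members of an obstruction set falsify `θ`, and compactness yields finite subsets that still do.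

From a program to finite obstructions: an instance falsifying `θ` has a falsifying preimage whose
small subsets have treewidth `(1, k)` (`MMSNP.exists_sparse`, by a sparse partite Ramsey
construction). There the program derives the goal, and since its IDB relations are monadic, the
derivation unfolds into preimages glued at single constants, giving a finite set of treewidth `(1,
k)` on which the program still holds. -/

lemma Atom.map_map {α β γ : Type} (f : α → β) (g : β → γ) (a : Atom S α) :
    (a.map f).map g = a.map (g ∘ f) := rfl

lemma Atom.vars_map {α β : Type} (f : α → β) (a : Atom S α) :
    (a.map f).vars = f '' a.vars := by
  simp [Atom.vars, Atom.map, ← Set.range_comp, Function.comp_def]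

lemma Atom.map_congr {α β : Type} {f g : α → β} {a : Atom S α} (h : ∀ x ∈ a.vars, f x = g x) :
    a.map f = a.map g := by
  unfold Atom.map
  congr 1
  funext i
  exact h _ ⟨i, rfl⟩

lemma Atom.map_eq_self {α : Type} {f : α → α} {a : Atom S α} (h : ∀ x ∈ a.vars, f x = x) :
    a.map f = a :=
  Atom.map_congr (g := id) h

instance Atom.instFinite {α : Type} [Finite α] : Finite (Atom S α) := by
  have := S.finite_sym
  refine Finite.of_injective (β := Σ s : S.Sym, Fin (S.arity s) → α) (fun a => ⟨a.sym, a.args⟩) ?_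
  rintro ⟨s, a⟩ ⟨t, b⟩ h
  simp only [Sigma.mk.injEq] at h
  obtain ⟨rfl, h⟩ := h
  rw [eq_of_heq h]

lemma Atom.finite_vars {α : Type} (a : Atom S α) : a.vars.Finite := Set.finite_range _

lemma adom_mono {I J : FactSet S} (h : I ⊆ J) : adom I ⊆ adom J :=
  fun _ ⟨f, hf, hc⟩ => ⟨f, h hf, hc⟩

lemma adom_union (I J : FactSet S) : adom (I ∪ J) = adom I ∪ adom J := by
  ext c
  constructor
  · rintro ⟨f, hf | hf, hc⟩
    exacts [Or.inl ⟨f, hf, hc⟩, Or.inr ⟨f, hf, hc⟩]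
  · rintro (h | h)
    exacts [adom_mono Set.subset_union_left h, adom_mono Set.subset_union_right h]

lemma adom_finite {I : FactSet S} (h : I.Finite) : (adom I).Finite := by
  have : adom I = ⋃ f ∈ I, f.vars := by ext; simp [adom]
  rw [this]
  exact h.biUnion fun f _ => f.finite_vars

lemma map_mem_adom {I J : FactSet S} {h : Const → Const} (hh : ∀ f ∈ I, f.map h ∈ J) {c : Const}
    (hc : c ∈ adom I) : h c ∈ adom J := by
  obtain ⟨f, hf, hc⟩ := hc
  exact ⟨_, hh f hf, by rw [Atom.vars_map]; exact ⟨c, hc, rfl⟩⟩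

lemma finite_setOf_vars_subset {A : Set Const} (hA : A.Finite) :
    {f : Atom S Const | f.vars ⊆ A}.Finite := by
  have := hA.to_subtype
  refine (Set.finite_range (fun f : Atom S A => f.map Subtype.val)).subset ?_
  intro f hf
  exact ⟨⟨f.sym, fun i => ⟨f.args i, hf ⟨i, rfl⟩⟩⟩, rfl⟩

lemma HomTo.trans {I J K : FactSet S} : HomTo I J → HomTo J K → HomTo I K := by
  rintro ⟨f, hf⟩ ⟨g, hg⟩
  exact ⟨g ∘ f, fun a ha => hg _ (hf a ha)⟩

lemma HomTo.of_subset {I J : FactSet S} (h : I ⊆ J) : HomTo I J :=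
  ⟨id, fun _ hf => h hf⟩

end Basics

/-! ### Witnesses, compactness, and discarding large facts -/

section Witness

variable {S : Schema} {θ : MMSNP S}

/-- `X` witnesses the truth of `θ` in `I`. -/
def MMSNP.Witness (θ : MMSNP S) (I : FactSet S) (X : Fin θ.numSO → Set Const) : Prop :=
  ∀ c ∈ θ.clauses, ∀ v : Fin θ.numFO → Const, (∀ x ∈ c.vars, v x ∈ adom I) → c.Sat I X v

lemma Implication.vars_of_head {n m : ℕ} {c : Implication S n m} {p} (h : p ∈ c.head) :
    p.2 ∈ c.vars := Or.inl ⟨p, h, rfl⟩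

lemma Implication.vars_of_bodySO {n m : ℕ} {c : Implication S n m} {p} (h : p ∈ c.bodySO) :
    p.2 ∈ c.vars := Or.inr (Or.inl ⟨p, h, rfl⟩)

lemma Implication.vars_of_bodyEDB {n m : ℕ} {c : Implication S n m} {a} (h : a ∈ c.bodyEDB) :
    a.vars ⊆ c.vars := fun _ hx => Or.inr (Or.inr ⟨a, h, hx⟩)

/-- A witness need not consist of subsets of the active domain. -/
lemma MMSNP.Witness.holds {I : FactSet S} {X : Fin θ.numSO → Set Const} (h : θ.Witness I X) :
    θ.Holds I := by
  refine ⟨fun i => X i ∩ adom I, fun i => Set.inter_subset_right, fun c hc v hv hSO hE => ?_⟩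
  obtain ⟨p, hp, hp'⟩ := h c hc v hv (fun p hp => (hSO p hp).1) hE
  exact ⟨p, hp, hp', hv _ (Implication.vars_of_head hp)⟩

lemma MMSNP.Holds.exists_witness {I : FactSet S} (h : θ.Holds I) : ∃ X, θ.Witness I X :=
  let ⟨X, _, hX⟩ := h
  ⟨X, hX⟩

/-- Pulling back a witness along a map that simulates all clause bodies. -/
lemma MMSNP.Holds.of_simulation {I J : FactSet S} (hJ : θ.Holds J) (h : Const → Const)
    (hadom : ∀ c ∈ adom I, h c ∈ adom J)
    (hfact : ∀ c ∈ θ.clauses, ∀ a ∈ c.bodyEDB, ∀ v : Fin θ.numFO → Const,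
      a.map v ∈ I → a.map (h ∘ v) ∈ J) : θ.Holds I := by
  obtain ⟨X, hX⟩ := hJ.exists_witness
  refine MMSNP.Witness.holds (X := fun i => h ⁻¹' X i) fun c hc v hv hSO hE => ?_
  exact hX c hc (h ∘ v) (fun x hx => hadom _ (hv x hx)) hSO
    (fun a ha => hfact c hc a ha v (hE a ha))

lemma MMSNP.Holds.of_homTo {I J : FactSet S} (hJ : θ.Holds J) (h : HomTo I J) : θ.Holds I := by
  obtain ⟨h, hh⟩ := h
  exact hJ.of_simulation h (fun c hc => map_mem_adom hh hc) fun _ _ a _ v ha => hh _ ha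

/-- Compactness: a set of facts all of whose finite subsets satisfy `θ` satisfies `θ`. -/
lemma MMSNP.holds_of_finite_subsets {O : FactSet S}
    (h : ∀ O' ⊆ O, O'.Finite → θ.Holds O') : θ.Holds O := by
  classical
  have h' : ∀ A : Finset (Atom S Const), ∃ X, θ.Witness (O ∩ ↑A) X := fun A =>
    (h _ Set.inter_subset_left (A.finite_toSet.inter_of_right O)).exists_witness
  choose X hX using h'
  -- The limit witness is the ultrafilter limit of the finite ones. A finite disjunction that holds
  -- for almost all `A` has a disjunct that does, which settles the heads.
  let U : Ultrafilter (Finset (Atom S Const)) := Ultrafilter.of Filter.atTop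
  have hU : (U : Filter (Finset (Atom S Const))) ≤ Filter.atTop := Ultrafilter.of_le _
  have hmem : ∀ f ∈ O, ∀ᶠ A : Finset (Atom S Const) in (U : Filter (Finset (Atom S Const))), f ∈ O ∩ (↑A : Set (Atom S Const)) := by
    intro f hf
    have := hU (Filter.mem_atTop ({f} : Finset (Atom S Const)))
    filter_upwards [this] with A hA
    exact ⟨hf, hA (Finset.mem_singleton_self f)⟩
  refine MMSNP.Witness.holds (X := fun i => {c | ∀ᶠ A : Finset (Atom S Const) in (U : Filter _), c ∈ X A i}) ?_
  intro c hc v hv hSO hE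
  have e1 : ∀ᶠ A : Finset (Atom S Const) in (U : Filter (Finset (Atom S Const))), ∀ p ∈ c.bodySO, v p.2 ∈ X A p.1 := by
    have : ∀ᶠ A : Finset (Atom S Const) in (U : Filter (Finset (Atom S Const))),
        ∀ p ∈ {p | p ∈ c.bodySO}, v p.2 ∈ X A p.1 :=
      (Filter.eventually_all_finite (List.finite_toSet _)).2 fun p hp => hSO p hp
    exact this
  have e2 : ∀ᶠ A : Finset (Atom S Const) in (U : Filter (Finset (Atom S Const))),
      ∀ a ∈ {a | a ∈ c.bodyEDB}, a.map v ∈ O ∩ (↑A : Set (Atom S Const)) :=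
    (Filter.eventually_all_finite (List.finite_toSet _)).2 fun a ha => hmem _ (hE a ha)
  have e3 : ∀ᶠ A : Finset (Atom S Const) in (U : Filter (Finset (Atom S Const))),
      ∀ x ∈ c.vars, v x ∈ adom (O ∩ (↑A : Set (Atom S Const))) := by
    refine (Filter.eventually_all_finite (Set.toFinite _)).2 fun x hx => ?_
    obtain ⟨f, hf, hxf⟩ := hv x hx
    filter_upwards [hmem f hf] with A hA
    exact ⟨f, hA, hxf⟩
  have e4 : ∀ᶠ A : Finset (Atom S Const) in (U : Filter (Finset (Atom S Const))),
      ∃ p ∈ {p | p ∈ c.head}, v p.2 ∈ X A p.1 := by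
    filter_upwards [e1, e2, e3] with A h1 h2 h3
    exact hX A c hc v h3 h1 h2
  exact (Ultrafilter.eventually_exists_mem_iff (List.finite_toSet _)).1 e4

lemma MMSNP.ncard_vars_le_diameter {c : Implication S θ.numSO θ.numFO} (hc : c ∈ θ.clauses) :
    c.vars.ncard ≤ θ.diameter := by
  unfold MMSNP.diameter
  generalize θ.clauses = l at hc
  induction l with
  | nil => simp at hc
  | cons d l ih =>
    rcases List.mem_cons.1 hc with rfl | h
    · simp
    · simpa using Or.inr (ih h)

/-- Facts with more than `θ.diameter` distinct constants are irrelevant for falsifying `θ`. -/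
lemma MMSNP.holds_of_small_facts {I : FactSet S}
    (harity : (∃ R, θ.diameter < S.arity R) →
      ∀ N : FactSet S, adom N = ∅ → θ.Holds N →
        ∃ I : FactSet S, I.Finite ∧ N ⊆ I ∧ (adom I).Nonempty ∧ θ.Holds I)
    (h : θ.Holds {f ∈ I | f.vars.ncard ≤ θ.diameter}) : θ.Holds I := by
  classical
  set I' : FactSet S := {f ∈ I | f.vars.ncard ≤ θ.diameter} with hI'
  have small : ∀ c ∈ θ.clauses, ∀ a ∈ c.bodyEDB, ∀ v : Fin θ.numFO → Const,
      a.map v ∈ I → a.map v ∈ I' := by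
    intro c hc a ha v hv
    refine ⟨hv, ?_⟩
    rw [Atom.vars_map]
    exact (Set.ncard_image_le a.finite_vars).trans
      ((Set.ncard_le_ncard (Implication.vars_of_bodyEDB ha) (Set.toFinite _)).trans
        (MMSNP.ncard_vars_le_diameter hc))
  by_cases hne : (adom I').Nonempty
  · obtain ⟨a₀, ha₀⟩ := hne
    -- Clause bodies match small facts only, so constants that occur only in large facts can be
    -- collapsed to `a₀`.
    refine h.of_simulation (fun c => if c ∈ adom I' then c else a₀) ?_ ?_
    · intro c _
      split_ifs with hc
      exacts [hc, ha₀]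
    · intro c hc a ha v hv
      have h1 := small c hc a ha v hv
      convert h1 using 1
      refine Atom.map_congr fun x hx => ?_
      have : v x ∈ adom I' := ⟨_, h1, by rw [Atom.vars_map]; exact ⟨x, hx, rfl⟩⟩
      simp [this]
  · rw [Set.not_nonempty_iff_eq_empty] at hne
    by_cases hI : I = I'
    · rwa [hI]
    have hbig : ∃ f ∈ I, f ∉ I' := by
      by_contra hcon
      push Not at hcon
      exact hI (Set.Subset.antisymm hcon (Set.sep_subset _ _))
    obtain ⟨f, hf, hf'⟩ := hbig
    have hlt : θ.diameter < f.vars.ncard := by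
      by_contra hcon
      exact hf' ⟨hf, not_lt.1 hcon⟩
    have hle : f.vars.ncard ≤ S.arity f.sym := by
      have := Set.ncard_image_le (f := f.args) (Set.finite_univ)
      rw [Set.image_univ, Set.ncard_univ, Nat.card_fin] at this
      exact this
    -- Here `I'` has no constants, whereas the large fact `f` gives `I` some. The arity hypothesis
    -- supplies a model with a constant onto which they can be collapsed.
    obtain ⟨I₂, -, hsub, ⟨a₀, ha₀⟩, h₂⟩ := harity ⟨f.sym, hlt.trans_le hle⟩ I' hne h
    refine h₂.of_simulation (fun _ => a₀) (fun _ _ => ha₀) ?_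
    intro c hc a ha v hv
    have h1 := small c hc a ha v hv
    convert hsub h1 using 1
    refine Atom.map_congr fun x hx => ?_
    have : v x ∈ adom I' := ⟨_, h1, by rw [Atom.vars_map]; exact ⟨x, hx, rfl⟩⟩
    simp [hne] at this

end Witness

/-! ### Rooted trees -/

section RootedTree

variable {V : Type} {T : SimpleGraph V}

/-- Geodesics from `r` to `w` and to `w'`, prolonged to `v`, are both paths from `r` to `v`, hence
equal, and have the same penultimate vertex. -/
lemma isTree_parent_unique (hT : T.IsTree) (r : V) {v w w' : V} (hw : T.Adj v w)
    (hw' : T.Adj v w') (h : T.dist r v = T.dist r w + 1) (h' : T.dist r v = T.dist r w' + 1) :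
    w = w' := by
  obtain ⟨p, hp⟩ := hT.connected.exists_walk_length_eq_dist r w
  obtain ⟨p', hp'⟩ := hT.connected.exists_walk_length_eq_dist r w'
  have h1 : (p.concat hw.symm).IsPath :=
    SimpleGraph.Walk.isPath_of_length_eq_dist _ (by simp [hp, h])
  have h2 : (p'.concat hw'.symm).IsPath :=
    SimpleGraph.Walk.isPath_of_length_eq_dist _ (by simp [hp', h'])
  have := (hT.existsUnique_path r v).unique h1 h2
  have h3 := congrArg SimpleGraph.Walk.penultimate this
  simpa using h3

/-- In a rooted tree every vertex but the root has a parent, and adjacent vertices are parent and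
child. -/
lemma isTree_exists_parent (hT : T.IsTree) (r : V) : ∃ par : V → V, par r = r ∧
    (∀ v, v ≠ r → T.dist r (par v) < T.dist r v) ∧
    ∀ v w, T.Adj v w → (w ≠ r ∧ par w = v) ∨ (v ≠ r ∧ par v = w) := by
  classical
  have ex : ∀ v, v ≠ r → ∃ w, T.Adj v w ∧ T.dist r v = T.dist r w + 1 := by
    intro v hv
    obtain ⟨p, hp⟩ := hT.connected.exists_walk_length_eq_dist v r
    cases p with
    | nil => exact absurd rfl hv
    | cons h q =>
      rename_i w
      refine ⟨w, h, ?_⟩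
      rcases hT.dist_eq_dist_add_one_of_adj r h with h1 | h1
      · exact h1
      · have := SimpleGraph.dist_le q
        rw [SimpleGraph.Walk.length_cons] at hp
        rw [SimpleGraph.dist_comm (u := r) (v := v), SimpleGraph.dist_comm (u := r) (v := w)] at h1
        omega
  choose! par hpar using ex
  refine ⟨fun v => if v = r then r else par v, by simp, ?_, ?_⟩
  · intro v hv
    have := (hpar v hv).2
    simp only [hv, if_false]
    omega
  · intro v w h
    have root : ∀ x y, T.dist r x = T.dist r y + 1 → x ≠ r := by
      rintro x y hxy rfl
      simp at hxy
    rcases hT.dist_eq_dist_add_one_of_adj r h with h1 | h1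
    · have hv := root _ _ h1
      refine Or.inr ⟨hv, ?_⟩
      simp only [hv, if_false]
      exact isTree_parent_unique hT r (hpar v hv).1 h (hpar v hv).2 h1
    · have hw := root _ _ h1
      refine Or.inl ⟨hw, ?_⟩
      simp only [hw, if_false]
      exact isTree_parent_unique hT r (hpar w hw).1 h.symm (hpar w hw).2 h1

/-- A connected set of vertices containing `e` and another vertex that is not farther from the
root contains the parent of `e`. -/
lemma parent_mem_of_connected {r : V} {par : V → V} (hr : par r = r)
    (hdist : ∀ v, v ≠ r → T.dist r (par v) < T.dist r v)
    (hadj : ∀ v w, T.Adj v w → (w ≠ r ∧ par w = v) ∨ (v ≠ r ∧ par v = w))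
    {A : Set V} (hA : (T.induce A).Preconnected) {e f : V} (he : e ∈ A) (hf : f ∈ A) (hne : f ≠ e)
    (hle : T.dist r f ≤ T.dist r e) : par e ∈ A := by
  -- A walk that starts at `e` inside `A` either visits the parent of `e` or stays among the
  -- descendants of `e`, all of which are farther from the root.
  have key : ∀ x : A, Relation.ReflTransGen (T.induce A).Adj ⟨e, he⟩ x →
      par e ∈ A ∨ ∃ n, par^[n] x = e := by
    intro x hx
    induction hx with
    | refl => exact Or.inr ⟨0, rfl⟩
    | @tail y z _ hyz ih =>
      rcases ih with h | ⟨n, hn⟩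
      · exact Or.inl h
      rcases hadj y z hyz with ⟨-, h⟩ | ⟨-, h⟩
      · refine Or.inr ⟨n + 1, ?_⟩
        rw [Function.iterate_succ_apply, h, hn]
      · rcases n with _ | n
        · left
          simp only [Function.iterate_zero, id_eq] at hn
          rw [← hn, h]
          exact z.2
        · refine Or.inr ⟨n, ?_⟩
          rw [Function.iterate_succ_apply, h] at hn
          exact hn
  have hle' : ∀ v, T.dist r (par v) ≤ T.dist r v := by
    intro v
    by_cases hv : v = r
    · rw [hv, hr]
    · exact (hdist v hv).le
  have hiter : ∀ n v, T.dist r (par^[n] v) ≤ T.dist r v := by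
    intro n
    induction n with
    | zero => simp
    | succ n ih =>
      intro v
      rw [Function.iterate_succ_apply]
      exact (ih _).trans (hle' v)
  rcases key ⟨f, hf⟩ ((SimpleGraph.reachable_iff_reflTransGen _ _).1 (hA _ _)) with h | ⟨n, hn⟩
  · exact h
  exfalso
  rcases n with _ | n
  · exact hne hn
  have hfr : f ≠ r := by
    rintro rfl
    have : ∀ m, par^[m] f = f := fun m => Function.iterate_fixed hr m
    exact hne ((this _).symm.trans hn)
  rw [Function.iterate_succ_apply] at hn
  have h1 := hiter n (par f)
  rw [hn] at h1
  have := hdist f hfr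
  omega

end RootedTree

/-! ### Hyperforests and coherent choices along tree decompositions -/

/-- Every nonempty set of at most `s` members of the family `inc` has a member that meets the union
of the others in at most one element. -/
def HasLeaves {E V : Type} (inc : E → Set V) (s : ℕ) : Prop :=
  ∀ F : Finset E, F.Nonempty → F.card ≤ s →
    ∃ e ∈ F, {x ∈ inc e | ∃ f ∈ F, f ≠ e ∧ x ∈ inc f}.Subsingleton

section Decomposition

variable {S : Schema} {I : FactSet S}

lemma TreeDecomposition.exists_mem_bag (D : TreeDecomposition I) {a : Const} (ha : a ∈ adom I) :
    ∃ v, a ∈ D.bag v :=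
  let ⟨v⟩ := (D.connected a ha).nonempty
  ⟨v.1, v.2⟩

lemma subsingleton_of_encard_le {A : Set Const} (h : A.encard ≤ ((1 : ℕ) : ℕ∞)) :
    A.Subsingleton := by
  rw [← Set.encard_le_one_iff_subsingleton]
  exact_mod_cast h

/-- A bag farthest from the root is a leaf: by connectedness, whatever it shares with the other bags
lies in its parent bag as well, and two bags share at most one constant. -/
lemma TreeDecomposition.hasLeaves (D : TreeDecomposition I)
    (hD : ∀ v w, v ≠ w → (D.bag v ∩ D.bag w).Subsingleton) (s : ℕ) : HasLeaves D.bag s := by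
  intro F hF _
  obtain ⟨r⟩ := D.isTree.connected.nonempty
  obtain ⟨par, hr, hdist, hadj⟩ := isTree_exists_parent D.isTree r
  obtain ⟨e, he, hmax⟩ := F.exists_max_image (fun v => D.T.dist r v) hF
  refine ⟨e, he, ?_⟩
  by_cases her : e = r
  · rintro x ⟨_, f, hf, hfe, _⟩
    have := hmax f hf
    rw [her, SimpleGraph.dist_self, Nat.le_zero, D.isTree.connected.dist_eq_zero_iff] at this
    exact absurd (this.symm.trans her.symm) hfe
  · refine (hD e (par e) ?_).anti ?_
    · intro h
      have := hdist e her
      rw [← h] at this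
      exact lt_irrefl _ this
    · rintro x ⟨hx, f, hf, hfe, hxf⟩
      have hc := D.connected x (D.bag_subset _ hx)
      exact ⟨hx, parent_mem_of_connected hr hdist hadj hc.preconnected hx hxf hfe (hmax f hf)⟩

/-- Local assignments on the bags that can be extended from a single element can be chosen
coherently. -/
lemma TreeDecomposition.exists_global (D : TreeDecomposition I)
    (hD : ∀ v w, v ≠ w → (D.bag v ∩ D.bag w).Subsingleton) {α : Type} [Nonempty α]
    (L : D.V → Set (Const → α)) (A : Const → Set α)
    (hLA : ∀ v, ∀ f ∈ L v, ∀ a ∈ D.bag v, f a ∈ A a) (hne : ∀ v, (L v).Nonempty)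
    (hext : ∀ v, ∀ a ∈ D.bag v, ∀ x ∈ A a, ∃ f ∈ L v, f a = x) :
    ∃ h : Const → α, ∀ v, ∃ f ∈ L v, ∀ a ∈ D.bag v, h a = f a := by
  classical
  -- Agreement with one other bag prescribes at most one value.
  have ext : ∀ v w, v ≠ w → ∀ f ∈ L w, ∃ f' ∈ L v, ∀ a ∈ D.bag v, a ∈ D.bag w → f' a = f a := by
    intro v w hvw f hf
    by_cases h : ∃ a, a ∈ D.bag v ∧ a ∈ D.bag w
    · obtain ⟨a, hav, haw⟩ := h
      obtain ⟨f', hf', hfa⟩ := hext v a hav (f a) (hLA w f hf a haw)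
      refine ⟨f', hf', fun b hbv hbw => ?_⟩
      rw [hD v w hvw ⟨hbv, hbw⟩ ⟨hav, haw⟩, hfa]
    · obtain ⟨f', hf'⟩ := hne v
      exact ⟨f', hf', fun a hv hw => absurd ⟨a, hv, hw⟩ h⟩
  obtain ⟨r⟩ := D.isTree.connected.nonempty
  obtain ⟨par, hr, hdist, hadj⟩ := isTree_exists_parent D.isTree r
  have parne : ∀ v, v ≠ r → v ≠ par v := by
    intro v hv h
    have := hdist v hv
    rw [← h] at this
    exact lt_irrefl _ this
  -- Choose from the root outwards, each bag in agreement with its parent.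
  let F : ∀ v, {f // f ∈ L v} := (measure (D.T.dist r)).wf.fix fun v rec =>
    if hv : v = r then ⟨(hne v).choose, (hne v).choose_spec⟩ else
      ⟨(ext v (par v) (parne v hv) _ (rec (par v) (hdist v hv)).2).choose,
        (ext v (par v) (parne v hv) _ (rec (par v) (hdist v hv)).2).choose_spec.1⟩
  have hF : ∀ v, v ≠ r → ∀ a ∈ D.bag v, a ∈ D.bag (par v) → (F v).1 a = (F (par v)).1 a := by
    intro v hv
    have : F v = ⟨(ext v (par v) (parne v hv) _ (F (par v)).2).choose,
        (ext v (par v) (parne v hv) _ (F (par v)).2).choose_spec.1⟩ := by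
      unfold F
      rw [WellFounded.fix_eq]
      simp [hv]
    rw [this]
    exact (ext v (par v) (parne v hv) _ (F (par v)).2).choose_spec.2
  have hFadj : ∀ v w, D.T.Adj v w → ∀ a ∈ D.bag v, a ∈ D.bag w → (F v).1 a = (F w).1 a := by
    intro v w h a hv hw
    rcases hadj v w h with ⟨h1, rfl⟩ | ⟨h1, rfl⟩
    · exact (hF _ h1 a hw hv).symm
    · exact hF _ h1 a hv hw
  have hFconn : ∀ v w, ∀ a ∈ D.bag v, a ∈ D.bag w → (F v).1 a = (F w).1 a := by
    intro v w a hv hw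
    have hc := (D.connected a (D.bag_subset _ hv)).preconnected ⟨v, hv⟩ ⟨w, hw⟩
    rw [SimpleGraph.reachable_iff_reflTransGen] at hc
    suffices ∀ x : {v | a ∈ D.bag v}, Relation.ReflTransGen (D.T.induce {v | a ∈ D.bag v}).Adj
        ⟨v, hv⟩ x → (F v).1 a = (F x).1 a from this _ hc
    intro x hx
    induction hx with
    | refl => rfl
    | @tail y z _ hyz ih => exact ih.trans (hFadj y z hyz a y.2 z.2)
  refine ⟨fun a => if h : ∃ v, a ∈ D.bag v then (F h.choose).1 a else Classical.arbitrary α,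
    fun v => ⟨(F v).1, (F v).2, fun a ha => ?_⟩⟩
  have h : ∃ v, a ∈ D.bag v := ⟨v, ha⟩
  simp only [dif_pos h]
  exact hFconn _ _ a h.choose_spec ha

end Decomposition

/-! ### Joining two trees by an edge -/

section GraphJoin

variable {V W : Type} {G : SimpleGraph V} {H : SimpleGraph W}

lemma isAcyclic_sum (hG : G.IsAcyclic) (hH : H.IsAcyclic) : (G ⊕g H).IsAcyclic := by
  rw [SimpleGraph.isAcyclic_iff_forall_adj_isBridge] at *
  have left : ∀ u v x, Relation.ReflTransGen
      ((G ⊕g H).deleteEdges {s(Sum.inl u, Sum.inl v)}).Adj (Sum.inl u) x →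
      ∃ y, x = Sum.inl y ∧ (G.deleteEdges {s(u, v)}).Reachable u y := by
    intro u v x hx
    induction hx with
    | refl => exact ⟨u, rfl, .rfl⟩
    | @tail y z _ hyz ih =>
      obtain ⟨y, rfl, hy⟩ := ih
      rcases z with z | z
      · refine ⟨z, rfl, hy.trans (SimpleGraph.Adj.reachable ?_)⟩
        simpa using hyz
      · simp at hyz
  have right : ∀ u v x, Relation.ReflTransGen
      ((G ⊕g H).deleteEdges {s(Sum.inr u, Sum.inr v)}).Adj (Sum.inr u) x →
      ∃ y, x = Sum.inr y ∧ (H.deleteEdges {s(u, v)}).Reachable u y := by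
    intro u v x hx
    induction hx with
    | refl => exact ⟨u, rfl, .rfl⟩
    | @tail y z _ hyz ih =>
      obtain ⟨y, rfl, hy⟩ := ih
      rcases z with z | z
      · simp at hyz
      · refine ⟨z, rfl, hy.trans (SimpleGraph.Adj.reachable ?_)⟩
        simpa using hyz
  rintro (u | u) (v | v) h hr
  · obtain ⟨y, hy, hy'⟩ := left u v _ ((SimpleGraph.reachable_iff_reflTransGen _ _).1 hr)
    obtain rfl := Sum.inl_injective hy
    exact hG (by simpa using h) hy'
  · simp at h
  · simp at h
  · obtain ⟨y, hy, hy'⟩ := right u v _ ((SimpleGraph.reachable_iff_reflTransGen _ _).1 hr)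
    obtain rfl := Sum.inr_injective hy
    exact hH (by simpa using h) hy'

lemma preconnected_induce_image (f : G →g H) {A : Set V} (hA : (G.induce A).Preconnected) :
    (H.induce (f '' A)).Preconnected := by
  rintro ⟨_, x, hx, rfl⟩ ⟨_, y, hy, rfl⟩
  let g : G.induce A →g H.induce (f '' A) :=
    ⟨fun z => ⟨f z, z, z.2, rfl⟩, fun {a b} h => f.map_adj h⟩
  exact (hA ⟨x, hx⟩ ⟨y, hy⟩).map g

/-- The two graphs joined by an edge between `u` and `w`. -/
def joinGraph (G : SimpleGraph V) (H : SimpleGraph W) (u : V) (w : W) : SimpleGraph (V ⊕ W) :=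
  (G ⊕g H) ⊔ SimpleGraph.edge (Sum.inl u) (Sum.inr w)

def joinInl (G : SimpleGraph V) (H : SimpleGraph W) (u : V) (w : W) : G →g joinGraph G H u w :=
  ⟨Sum.inl, fun h => Or.inl (by simpa using h)⟩

def joinInr (G : SimpleGraph V) (H : SimpleGraph W) (u : V) (w : W) : H →g joinGraph G H u w :=
  ⟨Sum.inr, fun h => Or.inl (by simpa using h)⟩

@[simp] lemma joinInl_apply (u : V) (w : W) (v : V) : joinInl G H u w v = Sum.inl v := rfl

@[simp] lemma joinInr_apply (u : V) (w : W) (v : W) : joinInr G H u w v = Sum.inr v := rfl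

lemma joinGraph_adj (u : V) (w : W) : (joinGraph G H u w).Adj (Sum.inl u) (Sum.inr w) := by
  right
  simp [SimpleGraph.edge_adj]

lemma joinGraph_isTree (hG : G.IsTree) (hH : H.IsTree) (u : V) (w : W) :
    (joinGraph G H u w).IsTree := by
  refine ⟨?_, (isAcyclic_sum hG.isAcyclic hH.isAcyclic).sup_edge_of_not_reachable
    (SimpleGraph.not_reachable_sum_inl_inr u w)⟩
  have : Nonempty (V ⊕ W) := ⟨Sum.inl u⟩
  have hl : ∀ x, (joinGraph G H u w).Reachable (Sum.inl u) x := by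
    rintro (x | x)
    · exact (hG.connected u x).map (joinInl G H u w)
    · exact (joinGraph_adj u w).reachable.trans ((hH.connected w x).map (joinInr G H u w))
  exact ⟨fun x y => (hl x).symm.trans (hl y)⟩

end GraphJoin

/-! ### Closure properties of treewidth -/

section Treewidth

variable {S : Schema} {I J : FactSet S} {l k : ℕ}

lemma HasTreewidth.of_adom_subset {A : Set Const} (hA : A.encard ≤ k) (h : adom I ⊆ A) :
    HasTreewidth l k I := by
  refine ⟨⟨Unit, ⊥, .of_subsingleton, fun _ => adom I, fun _ => le_rfl, fun a ha => ?_,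
    fun f hf => ⟨(), fun c hc => ⟨f, hf, hc⟩⟩⟩, fun v w h => absurd rfl h,
    fun _ => (Set.encard_le_encard h).trans hA⟩
  have : Nonempty {v : Unit | a ∈ adom I} := ⟨⟨(), ha⟩⟩
  exact ⟨fun x y => by rw [Subsingleton.elim x y]⟩

lemma HasTreewidth.subset (hJ : HasTreewidth l k J) (h : I ⊆ J) : HasTreewidth l k I := by
  obtain ⟨D, h1, h2⟩ := hJ
  refine ⟨⟨D.V, D.T, D.isTree, fun v => D.bag v ∩ adom I, fun _ => Set.inter_subset_right,
    fun a ha => ?_, fun f hf => ?_⟩, fun v w hvw => ?_, fun v => ?_⟩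
  · have : {v | a ∈ D.bag v ∩ adom I} = {v | a ∈ D.bag v} := by ext; simp [ha]
    rw [this]
    exact D.connected a (adom_mono h ha)
  · obtain ⟨v, hv⟩ := D.covers f (h hf)
    exact ⟨v, fun c hc => ⟨hv hc, f, hf, hc⟩⟩
  · exact (Set.encard_le_encard
      (Set.inter_subset_inter Set.inter_subset_left Set.inter_subset_left)).trans (h1 v w hvw)
  · exact (Set.encard_le_encard Set.inter_subset_left).trans (h2 v)

lemma HasTreewidth.image (hI : HasTreewidth l k I) {σ : Const → Const}
    (hσ : Function.Injective σ) : HasTreewidth l k (Atom.map σ '' I) := by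
  obtain ⟨D, h1, h2⟩ := hI
  refine ⟨⟨D.V, D.T, D.isTree, fun v => σ '' D.bag v, fun v => ?_, fun a ha => ?_, ?_⟩,
    fun v w hvw => ?_, fun v => ?_⟩
  · rintro _ ⟨c, hc, rfl⟩
    exact map_mem_adom (fun f hf => Set.mem_image_of_mem _ hf) (D.bag_subset v hc)
  · obtain ⟨_, ⟨f, hf, rfl⟩, hc⟩ := ha
    rw [Atom.vars_map] at hc
    obtain ⟨c, hc, rfl⟩ := hc
    have : {v | σ c ∈ σ '' D.bag v} = {v | c ∈ D.bag v} := by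
      ext v
      exact hσ.mem_set_image
    rw [this]
    exact D.connected c ⟨f, hf, hc⟩
  · rintro _ ⟨f, hf, rfl⟩
    obtain ⟨v, hv⟩ := D.covers f hf
    exact ⟨v, by rw [Atom.vars_map]; exact Set.image_mono hv⟩
  · rw [← Set.image_inter hσ, hσ.encard_image]
    exact h1 v w hvw
  · rw [hσ.encard_image]
    exact h2 v

/-- Gluing two sets of facts of treewidth `(1, k)` at no more than one constant. -/
lemma HasTreewidth.union (hI : HasTreewidth 1 k I) (hJ : HasTreewidth 1 k J)
    (hIJ : (adom I ∩ adom J).Subsingleton) : HasTreewidth 1 k (I ∪ J) := by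
  obtain ⟨D, h1, h2⟩ := hI
  obtain ⟨D', h1', h2'⟩ := hJ
  -- The new edge joins bags that contain the shared constant, if there is one, so that its
  -- occurrences stay connected.
  have hjoin : ∃ u w, ∀ a ∈ adom I, a ∈ adom J → a ∈ D.bag u ∧ a ∈ D'.bag w := by
    by_cases h : ∃ a, a ∈ adom I ∧ a ∈ adom J
    · obtain ⟨a, ha, ha'⟩ := h
      obtain ⟨u, hu⟩ := D.exists_mem_bag ha
      obtain ⟨w, hw⟩ := D'.exists_mem_bag ha'
      refine ⟨u, w, fun b hb hb' => ?_⟩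
      rw [hIJ ⟨hb, hb'⟩ ⟨ha, ha'⟩]
      exact ⟨hu, hw⟩
    · obtain ⟨u⟩ := D.isTree.connected.nonempty
      obtain ⟨w⟩ := D'.isTree.connected.nonempty
      exact ⟨u, w, fun a ha ha' => absurd ⟨a, ha, ha'⟩ h⟩
  obtain ⟨u, w, huw⟩ := hjoin
  let bag : D.V ⊕ D'.V → Set Const := Sum.elim D.bag D'.bag
  have hbag : ∀ a, {v | a ∈ bag v} =
      joinInl D.T D'.T u w '' {v | a ∈ D.bag v} ∪ joinInr D.T D'.T u w '' {v | a ∈ D'.bag v} := by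
    intro a
    ext (v | v) <;> simp [bag]
  have hcross : ∀ v v', (D.bag v ∩ D'.bag v').encard ≤ ((1 : ℕ) : ℕ∞) := by
    intro v v'
    have : (D.bag v ∩ D'.bag v').Subsingleton :=
      hIJ.anti (Set.inter_subset_inter (D.bag_subset v) (D'.bag_subset v'))
    exact_mod_cast Set.encard_le_one_iff_subsingleton.2 this
  refine ⟨⟨D.V ⊕ D'.V, joinGraph D.T D'.T u w, joinGraph_isTree D.isTree D'.isTree u w, bag,
    ?_, ?_, ?_⟩, ?_, ?_⟩
  · rintro (v | v)
    · exact (D.bag_subset v).trans (adom_mono Set.subset_union_left)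
    · exact (D'.bag_subset v).trans (adom_mono Set.subset_union_right)
  · intro a ha
    rw [hbag]
    rw [adom_union] at ha
    have hl : a ∉ adom I → {v | a ∈ D.bag v} = ∅ := fun h =>
      Set.eq_empty_of_forall_notMem fun v hv => h (D.bag_subset v hv)
    have hr : a ∉ adom J → {v | a ∈ D'.bag v} = ∅ := fun h =>
      Set.eq_empty_of_forall_notMem fun v hv => h (D'.bag_subset v hv)
    by_cases haI : a ∈ adom I
    · have cI := preconnected_induce_image (joinInl D.T D'.T u w) (D.connected a haI).preconnected
      by_cases haJ : a ∈ adom J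
      · have cJ := preconnected_induce_image (joinInr D.T D'.T u w)
          (D'.connected a haJ).preconnected
        obtain ⟨h3, h4⟩ := huw a haI haJ
        exact SimpleGraph.connected_induce_union cI cJ ⟨u, h3, rfl⟩ ⟨w, h4, rfl⟩
          (joinGraph_adj u w)
      · rw [hr haJ, Set.image_empty, Set.union_empty]
        obtain ⟨v, hv⟩ := D.exists_mem_bag haI
        exact @SimpleGraph.Connected.mk _ _ cI ⟨⟨_, v, hv, rfl⟩⟩
    · have haJ : a ∈ adom J := ha.resolve_left haI
      have cJ := preconnected_induce_image (joinInr D.T D'.T u w)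
          (D'.connected a haJ).preconnected
      rw [hl haI, Set.image_empty, Set.empty_union]
      obtain ⟨v, hv⟩ := D'.exists_mem_bag haJ
      exact @SimpleGraph.Connected.mk _ _ cJ ⟨⟨_, v, hv, rfl⟩⟩
  · rintro f (hf | hf)
    · obtain ⟨v, hv⟩ := D.covers f hf
      exact ⟨Sum.inl v, hv⟩
    · obtain ⟨v, hv⟩ := D'.covers f hf
      exact ⟨Sum.inr v, hv⟩
  · rintro (v | v) (v' | v') hne
    · exact h1 v v' fun h => hne (by rw [h])
    · exact hcross v v'
    · rw [Set.inter_comm]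
      exact hcross v' v
    · exact h1' v v' fun h => hne (by rw [h])
  · rintro (v | v)
    exacts [h2 v, h2' v]

end Treewidth

/-! ### Patterns and types -/

/-- A partial pattern over `m` variables: the variables in `dom` are to be mapped into the active
domain with the prescribed colors, those in `root` to a distinguished constant, and the atoms in
`atoms` to facts. -/
structure Pattern (S : Schema) (n m : ℕ) where
  dom : Set (Fin m)
  root : Set (Fin m)
  atoms : Set (Atom S (Fin m))
  col : Fin m → Set (Fin n)

section Types

variable {S : Schema} {n m : ℕ}

instance Pattern.instFinite : Finite (Pattern S n m) := by
  refine Finite.of_injective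
    (β := Set (Fin m) × Set (Fin m) × Set (Atom S (Fin m)) × (Fin m → Set (Fin n)))
    (fun p => (p.dom, p.root, p.atoms, p.col)) ?_
  rintro ⟨⟩ ⟨⟩ h
  simpa using h

/-- The color of a constant: the second-order variables that contain it. -/
def color (X : Fin n → Set Const) (a : Const) : Set (Fin n) := {i | a ∈ X i}

/-- The assignment `v` realizes the pattern `p`, with the distinguished constant `u` (if any). -/
def Pattern.RealizedBy (p : Pattern S n m) (D : FactSet S) (X : Fin n → Set Const)
    (u : Option Const) (v : Fin m → Const) : Prop :=
  (∀ y ∈ p.dom, v y ∈ adom D ∧ color X (v y) = p.col y) ∧ (∀ z ∈ p.root, some (v z) = u) ∧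
    ∀ a ∈ p.atoms, a.map v ∈ D

/-- The set of patterns that are realized. -/
def patternType (m : ℕ) (D : FactSet S) (X : Fin n → Set Const) (u : Option Const) :
    Set (Pattern S n m) :=
  {p | ∃ v, p.RealizedBy D X u v}

/-- Types of constants: a color and a set of realized patterns. -/
abbrev PType (S : Schema) (n m : ℕ) : Type := Set (Fin n) × Set (Pattern S n m)

/-- The type of a constant. -/
def typeOf (m : ℕ) (D : FactSet S) (X : Fin n → Set Const) (a : Const) : PType S n m :=
  (color X a, patternType m D X (some a))

/-- The global type is determined by the type of any constant. -/
lemma patternType_none (D : FactSet S) (X : Fin n → Set Const) (a : Const) :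
    patternType m D X none = {p ∈ patternType m D X (some a) | p.root = ∅} := by
  ext p
  constructor
  · rintro ⟨v, h1, h2, h3⟩
    have : p.root = ∅ := Set.eq_empty_of_forall_notMem fun z hz => by simpa using h2 z hz
    exact ⟨⟨v, h1, by simp [this], h3⟩, this⟩
  · rintro ⟨⟨v, h1, _, h3⟩, h⟩
    exact ⟨v, h1, by simp [h], h3⟩

end Types

/-! ### Gluing models along tree-like blocks -/

section Transfer

variable {S : Schema} {θ : MMSNP S}

/-- The pattern of the variables whose home is `w`. -/
def homePattern {n m : ℕ} (Y Z : Set (Fin m)) (Q : Set (Atom S (Fin m)))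
    (γ : Fin m → Set (Fin n)) (home : Fin m → Const) (w : Const) : Pattern S n m where
  dom := {i ∈ Y | home i = w}
  root := {i ∈ Z | home i = w}
  atoms := {a ∈ Q | a.vars.Nonempty ∧ ∀ i ∈ a.vars, home i = w}
  col := γ

/-- A set of facts covered by tree-like blocks satisfies `θ` if every block can be mapped in a
type-preserving way to a model of `θ`. The proof removes leaf blocks one by one, moving the variables
that live there to a virtual position at the attachment point. -/
lemma exists_realization_of_blocks {E : Type} [Nonempty E] (blk : E → Set Const)
    (facts : E → FactSet S) (hvars : ∀ e, ∀ f ∈ facts e, f.vars ⊆ blk e) {s : ℕ}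
    (hleaf : HasLeaves blk s) (ty : Const → PType S θ.numSO θ.numFO)
    (g₀ : Set (Pattern S θ.numSO θ.numFO))
    (hloc : ∀ e, ∃ D X ι, θ.Witness D X ∧ (∀ f ∈ facts e, f.map ι ∈ D) ∧
      (∀ w ∈ blk e, ι w ∈ adom D ∧ typeOf θ.numFO D X (ι w) = ty w) ∧
      patternType θ.numFO D X none = g₀)
    (Y : Set (Fin θ.numFO)) (Q : Set (Atom S (Fin θ.numFO))) (hQY : ∀ a ∈ Q, a.vars ⊆ Y)
    (γ : Fin θ.numFO → Set (Fin θ.numSO))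
    (hnull : ∀ a ∈ Q, a.vars = ∅ → ∃ e v, a.map v ∈ facts e)
    (F : Finset E) (hF : F.card ≤ s) (home : Fin θ.numFO → Const) (Z : Set (Fin θ.numFO))
    (Qv : Set (Atom S (Fin θ.numFO)))
    (hhome : ∀ y ∈ Y, ∃ e, home y ∈ blk e)
    (hpat : ∀ w, (∃ e, w ∈ blk e) → homePattern Y Z Qv γ home w ∈ (ty w).2)
    (hQ : ∀ a ∈ Q, a.vars = ∅ ∨ a ∈ Qv ∨ (a.vars ⊆ Z ∧ ∃ e ∈ F, a.map home ∈ facts e))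
    (hQv : ∀ a ∈ Qv, ∃ w, ∀ i ∈ a.vars, home i = w) :
    ∃ D X v, θ.Witness D X ∧ (∀ y ∈ Y, v y ∈ adom D ∧ color X (v y) = γ y) ∧
      ∀ a ∈ Q, a.map v ∈ D := by
  classical
  -- Variables in `Z` sit exactly at their home; the others live only virtually, in any model that
  -- realizes the type of their home. Atoms in `Qv` are already part of the pattern at one constant;
  -- every other atom with variables is exact and lies in a block of `F`.
  induction hn : F.card generalizing F home Z Qv with
  | zero =>
    rw [Finset.card_eq_zero] at hn
    subst hn
    obtain ⟨e₀⟩ := ‹Nonempty E›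
    obtain ⟨D₀, X₀, -, hW₀, -, -, hg₀⟩ := hloc e₀
    have hv : ∀ w, (∃ e, w ∈ blk e) → ∃ v : Fin θ.numFO → Const,
        (∀ y ∈ Y, home y = w → v y ∈ adom D₀ ∧ color X₀ (v y) = γ y) ∧
        ∀ a ∈ Qv, a.vars.Nonempty → (∀ i ∈ a.vars, home i = w) → a.map v ∈ D₀ := by
      intro w hw
      have hp := hpat w hw
      obtain ⟨e, he⟩ := hw
      obtain ⟨D, X, ι, -, -, hι, hg⟩ := hloc e
      rw [← (hι w he).2] at hp
      obtain ⟨v, h1, -, h3⟩ := hp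
      -- Without its root the pattern belongs to the global type, so it is also realized in the
      -- common model `D₀`.
      have : (⟨{i ∈ Y | home i = w}, ∅, {a ∈ Qv | a.vars.Nonempty ∧ ∀ i ∈ a.vars, home i = w},
          γ⟩ : Pattern S θ.numSO θ.numFO) ∈ patternType θ.numFO D X none :=
        ⟨v, h1, by simp, h3⟩
      rw [hg, ← hg₀] at this
      obtain ⟨v', h1, -, h3⟩ := this
      exact ⟨v', fun y hy hyw => h1 y ⟨hy, hyw⟩, fun a ha hne haw => h3 a ⟨ha, hne, haw⟩⟩
    choose! v hv1 hv2 using hv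
    refine ⟨D₀, X₀, fun i => v (home i) i, hW₀, fun y hy => hv1 _ (hhome y hy) y hy rfl, ?_⟩
    intro a ha
    by_cases hav : a.vars = ∅
    · obtain ⟨e, u, hu⟩ := hnull a ha hav
      obtain ⟨D, X, ι, -, hf, -, hg⟩ := hloc e
      have : (⟨∅, ∅, {a}, γ⟩ : Pattern S θ.numSO θ.numFO) ∈ patternType θ.numFO D X none :=
        ⟨ι ∘ u, by simp, by simp, by rintro _ rfl; exact hf _ hu⟩
      rw [hg, ← hg₀] at this
      obtain ⟨v', -, -, h3⟩ := this
      have h4 := h3 a rfl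
      rwa [Atom.map_congr (g := fun i => v (home i) i) (by simp [hav])] at h4
    · have hQa : a ∈ Qv := by simpa [hav] using hQ a ha
      obtain ⟨w, hw⟩ := hQv a hQa
      obtain ⟨i, hi⟩ := Set.nonempty_iff_ne_empty.2 hav
      have hwE : ∃ e, w ∈ blk e := hw i hi ▸ hhome i (hQY a ha hi)
      have h4 := hv2 w hwE a hQa ⟨i, hi⟩ hw
      rwa [Atom.map_congr (g := fun i => v (home i) i) (fun j hj => by rw [hw j hj])] at h4
  | succ N ih =>
    obtain ⟨e, he, hsub⟩ := hleaf F (Finset.card_pos.1 (by omega)) hF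
    have hcard : (F.erase e).card = N := by rw [Finset.card_erase_of_mem he]; omega
    by_cases hblk : blk e = ∅
    · refine ih (F.erase e) (by omega) home Z Qv hhome hpat ?_ hQv hcard
      intro a ha
      rcases hQ a ha with h | h | ⟨hZ, e', he', hae'⟩
      · exact Or.inl h
      · exact Or.inr (Or.inl h)
      · by_cases hee : e' = e
        · subst hee
          left
          have := hvars e' _ hae'
          rwa [hblk, Set.subset_empty_iff, Atom.vars_map, Set.image_eq_empty] at this
        · exact Or.inr (Or.inr ⟨hZ, e', Finset.mem_erase.2 ⟨hee, he'⟩, hae'⟩)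
    -- The attachment point of the leaf, or an arbitrary element of it if the leaf meets no other
    -- block of `F`.
    obtain ⟨y, hy, hshare⟩ : ∃ y ∈ blk e, ∀ x ∈ blk e, ∀ f ∈ F, f ≠ e → x ∈ blk f → x = y := by
      by_cases h : ∃ x ∈ blk e, ∃ f ∈ F, f ≠ e ∧ x ∈ blk f
      · obtain ⟨x, hx, hx'⟩ := h
        exact ⟨x, hx, fun z hz f hf hfe hzf => hsub ⟨hz, f, hf, hfe, hzf⟩ ⟨hx, hx'⟩⟩
      · obtain ⟨y, hy⟩ := Set.nonempty_iff_ne_empty.2 hblk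
        exact ⟨y, hy, fun x hx f hf hfe hxf => absurd ⟨x, hx, f, hf, hfe, hxf⟩ h⟩
    obtain ⟨D, X, ι, -, hDf, hDt, -⟩ := hloc e
    let home' : Fin θ.numFO → Const := fun i => if home i ∈ blk e then y else home i
    have home'_pos : ∀ i, home i ∈ blk e → home' i = y := fun i hi => by simp [home', hi]
    have home'_neg : ∀ i, home i ∉ blk e → home' i = home i := fun i hi => by simp [home', hi]
    have home'_y : ∀ i, home' i = y → home i ∈ blk e := by
      intro i hi
      by_contra hcon
      rw [home'_neg i hcon] at hi
      exact hcon (hi ▸ hy)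
    have home'_ne : ∀ i w, w ≠ y → home' i = w → home i = w ∧ home i ∉ blk e := by
      intro i w hw hi
      have : home i ∉ blk e := fun h => hw (hi.symm.trans (home'_pos i h))
      exact ⟨(home'_neg i this).symm.trans hi, this⟩
    -- Everything that lives on the leaf moves to `y`. What comes from another constant of the leaf
    -- becomes virtual, as do the atoms of the leaf.
    refine ih (F.erase e) (by omega) home' {i ∈ Z | home i ∈ blk e → home i = y}
      (Qv ∪ {a ∈ Q | a.vars ⊆ Z ∧ a.map home ∈ facts e}) ?_ ?_ ?_ ?_ hcard
    · intro i hi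
      by_cases h : home i ∈ blk e
      · exact ⟨e, by rw [home'_pos i h]; exact hy⟩
      · rw [home'_neg i h]
        exact hhome i hi
    · intro w hw
      by_cases hwy : w = y
      · subst hwy
        have hv : ∀ x ∈ blk e, ∃ v, (homePattern Y Z Qv γ home x).RealizedBy D X (some (ι x)) v := by
          intro x hx
          have := hpat x ⟨e, hx⟩
          rw [← (hDt x hx).2] at this
          exact this
        choose! v hv1 hv2 hv3 using hv
        rw [← (hDt w hy).2]
        -- The patterns at all constants of the leaf are realized in the same model `D`, so they can
        -- be merged; exact variables sit at `ι (home i)`, where the facts of the leaf hold.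
        refine ⟨fun i => v (home i) i, ?_, ?_, ?_⟩
        · rintro i ⟨hi, hiw⟩
          exact hv1 _ (home'_y i hiw) i ⟨hi, rfl⟩
        · rintro i ⟨⟨hi, hi'⟩, hiw⟩
          have h1 := hi' (home'_y i hiw)
          have h2 := hv2 _ (home'_y i hiw) i ⟨hi, rfl⟩
          dsimp only
          rw [h2, h1]
        · rintro a ⟨ha | ⟨haQ, haZ, haf⟩, hne, hall⟩
          · obtain ⟨x, hx⟩ := hQv a ha
            obtain ⟨i, hi⟩ := hne
            have hxb : x ∈ blk e := hx i hi ▸ home'_y i (hall i hi)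
            have := hv3 x hxb a ⟨ha, ⟨i, hi⟩, hx⟩
            rwa [Atom.map_congr (g := fun i => v (home i) i) (fun j hj => by rw [hx j hj])] at this
          · have := hDf _ haf
            rw [Atom.map_map] at this
            rwa [Atom.map_congr (g := fun i => v (home i) i)] at this
            intro i hi
            have h2 := hv2 _ (home'_y i (hall i hi)) i ⟨haZ hi, rfl⟩
            exact (Option.some_injective _ h2).symm
      · have hp := hpat w hw
        obtain ⟨e', he'⟩ := hw
        obtain ⟨D', X', ι', -, -, hDt', -⟩ := hloc e'
        rw [← (hDt' w he').2] at hp ⊢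
        obtain ⟨v, h1, h2, h3⟩ := hp
        refine ⟨v, ?_, ?_, ?_⟩
        · rintro i ⟨hi, hiw⟩
          exact h1 i ⟨hi, (home'_ne i w hwy hiw).1⟩
        · rintro i ⟨hi, hiw⟩
          exact h2 i ⟨hi.1, (home'_ne i w hwy hiw).1⟩
        · rintro a ⟨ha | ⟨haQ, haZ, haf⟩, hne, hall⟩
          · exact h3 a ⟨ha, hne, fun i hi => (home'_ne i w hwy (hall i hi)).1⟩
          · obtain ⟨i, hi⟩ := hne
            refine absurd (hvars e _ haf ?_) (home'_ne i w hwy (hall i hi)).2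
            rw [Atom.vars_map]
            exact ⟨i, hi, rfl⟩
    · intro a ha
      rcases hQ a ha with h | h | ⟨hZ, e', he', hae'⟩
      · exact Or.inl h
      · exact Or.inr (Or.inl (Or.inl h))
      · by_cases hee : e' = e
        · subst hee
          exact Or.inr (Or.inl (Or.inr ⟨ha, hZ, hae'⟩))
        · have hin : ∀ i ∈ a.vars, home i ∈ blk e → home i = y := by
            intro i hi hie
            refine hshare _ hie e' he' hee (hvars e' _ hae' ?_)
            rw [Atom.vars_map]
            exact ⟨i, hi, rfl⟩
          refine Or.inr (Or.inr ⟨fun i hi => ⟨hZ hi, hin i hi⟩, e',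
            Finset.mem_erase.2 ⟨hee, he'⟩, ?_⟩)
          rwa [Atom.map_congr (g := home) (fun i hi => ?_)]
          by_cases h : home i ∈ blk e
          · rw [home'_pos i h, hin i hi h]
          · exact home'_neg i h
    · rintro a (ha | ⟨haQ, haZ, haf⟩)
      · obtain ⟨w, hw⟩ := hQv a ha
        refine ⟨if w ∈ blk e then y else w, fun i hi => ?_⟩
        simp only [home', hw i hi]
      · refine ⟨y, fun i hi => home'_pos i (hvars e _ haf ?_)⟩
        rw [Atom.vars_map]
        exact ⟨i, hi, rfl⟩

/-- The colors contained in the types serve as witness. The body atoms of a clause lie in at most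
`s` blocks, so the body, with its colors, is realized in one model of `θ`, where some head atom is
true; its color is the same in `M`. -/
theorem MMSNP.holds_of_blocks {E : Type} [Nonempty E] {M : FactSet S} (blk : E → Set Const)
    (facts : E → FactSet S) (hM : ∀ f ∈ M, ∃ e, f ∈ facts e)
    (hvars : ∀ e, ∀ f ∈ facts e, f.vars ⊆ blk e) {s : ℕ}
    (hs : ∀ c ∈ θ.clauses, c.bodyEDB.length ≤ s)
    (hleaf : HasLeaves blk s) (ty : Const → PType S θ.numSO θ.numFO)
    (g₀ : Set (Pattern S θ.numSO θ.numFO))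
    (hloc : ∀ e, ∃ D X ι, θ.Witness D X ∧ (∀ f ∈ facts e, f.map ι ∈ D) ∧
      (∀ w ∈ blk e, ι w ∈ adom D ∧ typeOf θ.numFO D X (ι w) = ty w) ∧
      patternType θ.numFO D X none = g₀) : θ.Holds M := by
  classical
  refine MMSNP.Witness.holds (X := fun i => {w | i ∈ (ty w).1}) ?_
  intro c hc v hv hSO hE
  have hE' : ∀ a : Atom S (Fin θ.numFO), ∃ e, a ∈ c.bodyEDB → a.map v ∈ facts e := by
    intro a
    by_cases ha : a ∈ c.bodyEDB
    · obtain ⟨e, he⟩ := hM _ (hE a ha)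
      exact ⟨e, fun _ => he⟩
    · exact ⟨Classical.arbitrary E, fun h => absurd h ha⟩
  choose e he using hE'
  have hadom : ∀ w ∈ adom M, ∃ e, w ∈ blk e := by
    rintro w ⟨f, hf, hw⟩
    obtain ⟨e, he⟩ := hM f hf
    exact ⟨e, hvars e f he hw⟩
  obtain ⟨D, X, v', hW, h1, h2⟩ := exists_realization_of_blocks (θ := θ) blk facts hvars hleaf ty g₀
    hloc c.vars {a | a ∈ c.bodyEDB} (fun a ha => Implication.vars_of_bodyEDB ha)
    (fun i => (ty (v i)).1) (fun a ha _ => ⟨e a, v, he a ha⟩)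
    (c.bodyEDB.map e).toFinset
    ((List.toFinset_card_le _).trans (by simpa using hs c hc)) v Set.univ ∅
    (fun y hy => hadom _ (hv y hy))
    (by
      rintro w ⟨e, hw⟩
      obtain ⟨D, X, ι, -, -, hι, -⟩ := hloc e
      have h := hι w hw
      rw [← h.2]
      -- At the start every variable is exact and no atom is virtual, so a constant assignment
      -- realizes the pattern.
      refine ⟨fun _ => ι w, ?_, fun _ _ => rfl, by simp [homePattern]⟩
      rintro i ⟨-, hi⟩
      refine ⟨h.1, ?_⟩
      change color X (ι w) = (ty (v i)).1
      rw [hi, ← h.2]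
      rfl)
    (by
      intro a ha
      refine Or.inr (Or.inr ⟨Set.subset_univ _, e a, ?_, he a ha⟩)
      rw [List.mem_toFinset]
      exact List.mem_map_of_mem ha)
    (by simp)
  have hcol : ∀ x ∈ c.vars, ∀ i, v' x ∈ X i ↔ i ∈ (ty (v x)).1 := by
    intro x hx i
    rw [← (h1 x hx).2]
    rfl
  obtain ⟨p, hp, hp'⟩ := hW c hc v' (fun x hx => (h1 x hx).1)
    (fun p hp => (hcol _ (Implication.vars_of_bodySO hp) _).2 (hSO p hp)) h2
  exact ⟨p, hp, (hcol _ (Implication.vars_of_head hp) _).1 hp'⟩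

end Transfer

section Auxiliary

variable {S : Schema}

lemma Atom.exists_map_eq {α β : Type} {e : α → β} {f : Atom S β} (h : f.vars ⊆ Set.range e) :
    ∃ a : Atom S α, a.map e = f := by
  have : ∀ i, ∃ x, e x = f.args i := fun i => h ⟨i, rfl⟩
  choose x hx using this
  exact ⟨⟨f.sym, x⟩, by simp [Atom.map, hx]⟩

lemma exists_enumeration {A : Set Const} {k : ℕ} (hA : A.encard ≤ k) :
    ∃ j ≤ k, ∃ e : Fin j → Const, Function.Injective e ∧ Set.range e = A := by
  have hfin : A.Finite := Set.finite_of_encard_le_coe hA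
  refine ⟨A.ncard, ?_, ?_⟩
  · rw [← hfin.cast_ncard_eq] at hA
    exact_mod_cast hA
  · have := hfin.to_subtype
    let e : A ≃ Fin A.ncard := Finite.equivFinOfCardEq (Nat.card_coe_set_eq A)
    refine ⟨fun i => (e.symm i).1, fun i i' h => e.symm.injective (Subtype.ext h), ?_⟩
    ext a
    constructor
    · rintro ⟨i, rfl⟩
      exact (e.symm i).2
    · intro ha
      exact ⟨e ⟨a, ha⟩, by simp⟩

lemma MMSNP.exists_body_bound (θ : MMSNP S) : ∃ s, ∀ c ∈ θ.clauses, c.bodyEDB.length ≤ s := by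
  obtain ⟨s, hs⟩ := (((List.finite_toSet θ.clauses).image fun c => c.bodyEDB.length)).bddAbove
  exact ⟨s, fun c hc => hs ⟨c, hc, rfl⟩⟩

end Auxiliary

section Preservation

variable {S : Schema}

lemma DatalogRule.Sat.preimage {P : Schema} {r : DatalogRule S P} {I J : FactSet S}
    {K : FactSet P} {g : Prop} (hr : r.Sat J K g) {h : Const → Const}
    (hh : ∀ f ∈ I, f.map h ∈ J) : r.Sat I {f | f.map h ∈ K} g := by
  intro v hE hI
  have := hr (h ∘ v) (fun a ha => hh _ (hE a ha)) hI
  revert this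
  cases r.head <;> exact id

lemma DatalogProgram.Holds.of_homTo {Γ : DatalogProgram S} {I J : FactSet S} (hI : Γ.Holds I)
    (h : HomTo I J) : Γ.Holds J := by
  obtain ⟨h, hh⟩ := h
  intro K g hK
  exact hI _ g fun r hr => (hK r hr).preimage hh

end Preservation

/-! ### The canonical monadic Datalog program -/

section Canonical

variable {S : Schema} (θ : MMSNP S)

/-- The intensional schema of the canonical program: unary relations for sets of types and nullary
relations for sets of global types. -/
def canonicalIDB : Schema where
  Sym := Set (PType S θ.numSO θ.numFO) ⊕ Set (Set (Pattern S θ.numSO θ.numFO))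
  finite_sym := inferInstance
  arity := Sum.elim (fun _ => 1) (fun _ => 0)

variable {θ}

def unaryAtom {α : Type} (T : Set (PType S θ.numSO θ.numFO)) (x : α) : Atom (canonicalIDB θ) α :=
  ⟨Sum.inl T, fun _ => x⟩

variable (θ) in
def nullaryAtom (α : Type) (T : Set (Set (Pattern S θ.numSO θ.numFO))) :
    Atom (canonicalIDB θ) α :=
  ⟨Sum.inr T, fun i => Fin.elim0 (show Fin 0 from i)⟩

lemma unaryAtom_map {α β : Type} (T : Set (PType S θ.numSO θ.numFO)) (x : α) (f : α → β) :
    (unaryAtom T x).map f = unaryAtom T (f x) := rfl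

lemma nullaryAtom_map {α β : Type} (T : Set (Set (Pattern S θ.numSO θ.numFO))) (f : α → β) :
    (nullaryAtom θ α T).map f = nullaryAtom θ β T := by
  unfold nullaryAtom Atom.map
  congr 1
  funext i
  exact Fin.elim0 (show Fin 0 from i)

variable (θ) in
/-- The intended interpretation of the intensional relations in a model of `θ`. -/
def typeFacts (D : FactSet S) (X : Fin θ.numSO → Set Const) : FactSet (canonicalIDB θ) :=
  {f | (∃ T a, f = unaryAtom T a ∧ a ∈ adom D ∧ typeOf θ.numFO D X a ∈ T) ∨
    ∃ T, f = nullaryAtom θ Const T ∧ patternType θ.numFO D X none ∈ T}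

lemma unaryAtom_mem_typeFacts {D : FactSet S} {X : Fin θ.numSO → Set Const}
    {T : Set (PType S θ.numSO θ.numFO)} {a : Const} :
    unaryAtom T a ∈ typeFacts θ D X ↔ a ∈ adom D ∧ typeOf θ.numFO D X a ∈ T := by
  constructor
  · rintro (⟨T', a', h, h1, h2⟩ | ⟨T', h, -⟩)
    · have hT : T = T' := Sum.inl_injective (congrArg Atom.sym h)
      subst hT
      have ha : a = a' := congrFun (eq_of_heq (Atom.mk.inj h).2) (0 : Fin 1)
      subst ha
      exact ⟨h1, h2⟩
    · exact absurd (congrArg Atom.sym h) Sum.inl_ne_inr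
  · rintro ⟨h1, h2⟩
    exact Or.inl ⟨T, a, rfl, h1, h2⟩

lemma nullaryAtom_mem_typeFacts {D : FactSet S} {X : Fin θ.numSO → Set Const}
    {T : Set (Set (Pattern S θ.numSO θ.numFO))} :
    nullaryAtom θ Const T ∈ typeFacts θ D X ↔ patternType θ.numFO D X none ∈ T := by
  constructor
  · rintro (⟨T', a', h, -, -⟩ | ⟨T', h, h1⟩)
    · exact absurd (congrArg Atom.sym h) Sum.inr_ne_inl
    · have hT : T = T' := Sum.inr_injective (congrArg Atom.sym h)
      subst hT
      exact h1
  · intro h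
    exact Or.inr ⟨T, rfl, h⟩

/-- A rule is sound if it is true in all models of `θ` under the intended interpretation. -/
def IsSoundRule (r : DatalogRule S (canonicalIDB θ)) : Prop :=
  ∀ D X, θ.Witness D X → r.Sat D (typeFacts θ D X) False

open Classical in
/-- The rule with the given body and head; trivially true atoms are added to the body. -/
noncomputable def canonicalRule (j : ℕ) (B : Set (Atom S (Fin j)))
    (C : Set (Atom (canonicalIDB θ) (Fin j))) (head : Option (Atom (canonicalIDB θ) (Fin j))) :
    DatalogRule S (canonicalIDB θ) where
  numVars := j
  head := head
  bodyEDB := B.toFinite.toFinset.toList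
  bodyIDB := nullaryAtom θ _ Set.univ ::
    (C ∪ Set.range (unaryAtom Set.univ)).toFinite.toFinset.toList
  body_nonempty := Or.inr (by simp)
  head_safe := fun h _ x _ => Or.inr ⟨unaryAtom Set.univ x, by simp, ⟨(0 : Fin 1), rfl⟩⟩

lemma canonicalRule_sat_iff {j : ℕ} {B : Set (Atom S (Fin j))}
    {C : Set (Atom (canonicalIDB θ) (Fin j))} {head : Option (Atom (canonicalIDB θ) (Fin j))}
    {D : FactSet S} {K : FactSet (canonicalIDB θ)} {g : Prop} :
    (canonicalRule j B C head).Sat D K g ↔ ∀ v : Fin j → Const, (∀ a ∈ B, a.map v ∈ D) →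
      (∀ a ∈ C, a.map v ∈ K) → nullaryAtom θ Const Set.univ ∈ K →
      (∀ i, unaryAtom Set.univ (v i) ∈ K) → (∀ h ∈ head, h.map v ∈ K) ∧ (head = none → g) := by
  classical
  have hB : ∀ a, a ∈ (canonicalRule j B C head).bodyEDB ↔ a ∈ B := fun a =>
    Finset.mem_toList.trans (Set.Finite.mem_toFinset _)
  have hC : ∀ a, a ∈ (canonicalRule j B C head).bodyIDB ↔
      a = nullaryAtom θ _ Set.univ ∨ a ∈ C ∨ a ∈ Set.range (unaryAtom Set.univ) := fun a =>
    List.mem_cons.trans (or_congr Iff.rfl (Finset.mem_toList.trans (Set.Finite.mem_toFinset _)))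
  constructor
  · intro h v hvB hvC hnull hun
    have h' := h v (fun a ha => hvB a ((hB a).1 ha)) fun a ha => by
      rcases (hC a).1 ha with h | h | ⟨i, h⟩
      · subst h
        exact (nullaryAtom_map _ v).symm ▸ hnull
      · exact hvC a h
      · subst h
        exact hun i
    cases head with
    | none => exact ⟨by simp, fun _ => h'⟩
    | some a => exact ⟨by rintro _ ⟨⟩; exact h', by simp⟩
  · intro h v hE hI
    have h' := h v (fun a ha => hE a ((hB a).2 ha))
      (fun a ha => hI a ((hC a).2 (Or.inr (Or.inl ha))))
      (nullaryAtom_map _ v ▸ hI _ ((hC _).2 (Or.inl rfl)))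
      fun i => hI _ ((hC _).2 (Or.inr (Or.inr ⟨i, rfl⟩)))
    cases head with
    | none => exact h'.2 rfl
    | some a => exact h'.1 a rfl

/-- The rule deriving the trivially true facts about an extensional fact. -/
def initialRule (R : S.Sym) (x : Option (Fin (S.arity R))) : DatalogRule S (canonicalIDB θ) where
  numVars := S.arity R
  head := some (x.elim (nullaryAtom θ _ Set.univ) (unaryAtom Set.univ))
  bodyEDB := [⟨R, id⟩]
  bodyIDB := []
  body_nonempty := Or.inl (by simp)
  head_safe := fun h _ x _ => Or.inl ⟨_, List.mem_singleton_self _, ⟨x, rfl⟩⟩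

lemma isSoundRule_initialRule (R : S.Sym) (x : Option (Fin (S.arity R))) :
    IsSoundRule (θ := θ) (initialRule R x) := by
  intro D X _ v hE _
  have hE : (⟨R, v⟩ : Atom S Const) ∈ D := hE ⟨R, id⟩ (List.mem_singleton_self _)
  cases x with
  | none =>
    change (nullaryAtom θ _ Set.univ).map v ∈ _
    rw [nullaryAtom_map, nullaryAtom_mem_typeFacts]
    trivial
  | some i =>
    change unaryAtom Set.univ (v i) ∈ _
    rw [unaryAtom_mem_typeFacts]
    exact ⟨⟨_, hE, ⟨i, rfl⟩⟩, trivial⟩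

variable (θ) in
/-- The candidate rules of the canonical program with at most `k` variables. -/
def candidateRules (k : ℕ) : Set (DatalogRule S (canonicalIDB θ)) :=
  (Set.range fun p : Σ j : Fin (k + 1), Set (Atom S (Fin j)) × Set (Atom (canonicalIDB θ) (Fin j)) ×
      Option (Atom (canonicalIDB θ) (Fin j)) => canonicalRule p.1 p.2.1 p.2.2.1 p.2.2.2) ∪
    Set.range fun p : Σ R : S.Sym, Option (Fin (S.arity R)) => initialRule p.1 p.2

lemma candidateRules_finite (k : ℕ) : (candidateRules θ k).Finite := by
  have := S.finite_sym
  exact (Set.finite_range _).union (Set.finite_range _)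

variable (θ) in
/-- The canonical monadic Datalog program with at most `k` variables per proper rule. -/
noncomputable def canonicalProgram (k : ℕ) : DatalogProgram S where
  idb := canonicalIDB θ
  rules := ((candidateRules_finite (θ := θ) k).subset
    (Set.sep_subset _ fun r => IsSoundRule r)).toFinset.toList

lemma mem_canonicalProgram {k : ℕ} {r : DatalogRule S (canonicalIDB θ)} :
    r ∈ (canonicalProgram θ k).rules ↔ r ∈ candidateRules θ k ∧ IsSoundRule r := by
  exact Finset.mem_toList.trans (Set.Finite.mem_toFinset _)

lemma canonicalProgram_isMonadic (k : ℕ) : (canonicalProgram θ k).IsMonadic := by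
  rintro (T | T)
  · exact le_rfl
  · exact Nat.zero_le 1

/-- The intended interpretation in a model of `θ` is closed under all sound rules without deriving
the goal. -/
lemma canonicalProgram_sound {k : ℕ} {I : FactSet S} (h : (canonicalProgram θ k).Holds I) :
    ¬ θ.Holds I := by
  intro hI
  obtain ⟨X, hX⟩ := hI.exists_witness
  exact h (typeFacts θ I X) False fun r hr => (mem_canonicalProgram.1 hr).2 I X hX

/-- A head that is not derived is not entailed: there is a model of `θ` in which it fails. -/
lemma exists_countermodel {k : ℕ} {O : FactSet S} {K : FactSet (canonicalIDB θ)}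
    (hK : ∀ r ∈ candidateRules θ k, IsSoundRule r → r.Sat O K False) (hO : O.Nonempty) {j : ℕ}
    (hj : j ≤ k) (e : Fin j → Const) (he : ∀ i, e i ∈ adom O)
    (head : Option (Atom (canonicalIDB θ) (Fin j))) (hhead : ∀ h ∈ head, h.map e ∉ K) :
    ∃ D X v, θ.Witness D X ∧ (∀ a : Atom S (Fin j), a.map e ∈ O → a.map v ∈ D) ∧
      (∀ i, v i ∈ adom D) ∧
      (∀ i T, unaryAtom T (e i) ∈ K → typeOf θ.numFO D X (v i) ∈ T) ∧
      (∀ T, nullaryAtom θ Const T ∈ K → patternType θ.numFO D X none ∈ T) ∧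
      ∀ h ∈ head, h.map v ∉ typeFacts θ D X := by
  classical
  have hinit : ∀ f ∈ O, ∀ x, ((x : Option (Fin (S.arity f.sym))).elim (nullaryAtom θ _ Set.univ)
      (unaryAtom Set.univ)).map f.args ∈ K := by
    intro f hf x
    refine hK _ (Or.inr ⟨⟨f.sym, x⟩, rfl⟩) (isSoundRule_initialRule _ _) f.args ?_ (fun a ha => absurd ha List.not_mem_nil)
    intro a ha
    rw [List.mem_singleton.1 ha]
    exact hf
  have hnull : nullaryAtom θ Const Set.univ ∈ K := by
    obtain ⟨f, hf⟩ := hO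
    have := hinit f hf none
    rwa [Option.elim_none, nullaryAtom_map] at this
  have hun : ∀ c ∈ adom O, unaryAtom Set.univ c ∈ K := by
    rintro c ⟨f, hf, i, rfl⟩
    exact hinit f hf (some i)
  -- The body lists all that is known about the tuple `e`. Were the rule sound, it would fire at `e`
  -- and yield the head.
  have hunsound : ¬ IsSoundRule (canonicalRule j {a | a.map e ∈ O} {a | a.map e ∈ K} head) := by
    intro hs
    have := canonicalRule_sat_iff.1
      (hK _ (Or.inl ⟨⟨⟨j, Nat.lt_succ_of_le hj⟩, _, _, _⟩, rfl⟩) hs) e (fun a ha => ha)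
      (fun a ha => ha) hnull (fun i => hun _ (he i))
    cases head with
    | none => exact this.2 rfl
    | some h => exact hhead h rfl (this.1 h rfl)
  simp only [IsSoundRule, canonicalRule_sat_iff, not_forall] at hunsound
  obtain ⟨D, X, hW, v, hE, hI, hn, hu, hfail⟩ := hunsound
  refine ⟨D, X, v, hW, hE, fun i => (unaryAtom_mem_typeFacts.1 (hu i)).1,
    fun i T hT => (unaryAtom_mem_typeFacts.1 (hI (unaryAtom T i) hT)).2, fun T hT => ?_, ?_⟩
  · have := hI (nullaryAtom θ _ T) (by
      change Atom.map e _ ∈ K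
      rwa [nullaryAtom_map])
    rwa [nullaryAtom_map, nullaryAtom_mem_typeFacts] at this
  · rintro h hh hmem
    obtain rfl : head = some h := hh
    exact hfail ⟨by rintro _ ⟨⟩; exact hmem, by simp⟩

/-- The canonical program refutes all obstructions of treewidth `(1, k)`. -/
theorem canonicalProgram_complete {k : ℕ} {O : FactSet S} (hO : HasTreewidth 1 k O)
    (hempty : θ.Holds ∅) (hOθ : ¬ θ.Holds O) : (canonicalProgram θ k).Holds O := by
  classical
  intro (K : FactSet (canonicalIDB θ)) g hK'
  have hK : ∀ r ∈ candidateRules θ k, IsSoundRule r → r.Sat O K g :=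
    fun r hr hs => hK' r (mem_canonicalProgram.2 ⟨hr, hs⟩)
  clear hK'
  by_contra hg
  replace hg : g = False := eq_false hg
  subst hg
  apply hOθ
  obtain ⟨D, h1, hsize⟩ := hO
  have hD : ∀ v w, v ≠ w → (D.bag v ∩ D.bag w).Subsingleton :=
    fun v w h => subsingleton_of_encard_le (h1 v w h)
  -- Rule bodies are non-empty, so nothing can be derived from the empty set; this is where `hempty`
  -- is needed.
  have hne : O.Nonempty := by
    rw [Set.nonempty_iff_ne_empty]
    rintro rfl
    exact hOθ hempty
  -- The goal is not derived, so some global type `g₀` is compatible with all derived nullary facts;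
  -- it is fixed for all bags.
  obtain ⟨D₀, X₀, -, -, -, -, -, hg₀, -⟩ := exists_countermodel hK hne (Nat.zero_le k)
    (fun i => Fin.elim0 i) (fun i => Fin.elim0 i) none (by simp)
  set g₀ := patternType θ.numFO D₀ X₀ none
  -- `A a` collects the types at `a` not excluded by derived facts, `L v` the typings of a bag that
  -- are realized in one model.
  let A : Const → Set (PType S θ.numSO θ.numFO) := fun a =>
    {t | (∀ T, unaryAtom T a ∈ K → t ∈ T) ∧ {p ∈ t.2 | p.root = ∅} = g₀}
  let L : D.V → Set (Const → PType S θ.numSO θ.numFO) := fun v =>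
    {t | ∃ N X ι, θ.Witness N X ∧ (∀ f ∈ O, f.vars ⊆ D.bag v → f.map ι ∈ N) ∧
      (∀ a ∈ D.bag v, ι a ∈ adom N ∧ typeOf θ.numFO N X (ι a) = t a ∧
        ∀ T, unaryAtom T a ∈ K → t a ∈ T) ∧ patternType θ.numFO N X none = g₀}
  have hLocal : ∀ v, ∀ head : D.bag v ⊕ Unit, ∀ t : PType S θ.numSO θ.numFO,
      (∀ a, head = Sum.inl a → t ∈ A a) →
      ∃ f ∈ L v, ∀ a, head = Sum.inl a → f a = t := by
    intro v head t ht
    obtain ⟨j, hj, e, heinj, he⟩ := exists_enumeration (hsize v)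
    have hemem : ∀ i, e i ∈ D.bag v := fun i => he ▸ Set.mem_range_self i
    have hcounter : ∃ N X u, θ.Witness N X ∧ (∀ a : Atom S (Fin j), a.map e ∈ O → a.map u ∈ N) ∧
      (∀ i, u i ∈ adom N) ∧
      (∀ i T, unaryAtom T (e i) ∈ K → typeOf θ.numFO N X (u i) ∈ T) ∧
      patternType θ.numFO N X none = g₀ ∧
      ∀ i a, head = Sum.inl a → e i = a → typeOf θ.numFO N X (u i) = t := by
      rcases head with a | x
      · obtain ⟨i, hi⟩ : ∃ i, e i = a := he.ge a.2
        have hta := ht a rfl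
        -- The head states that the type differs from `t`. It is not derived because `t` is not
        -- excluded, so a countermodel gives `a` exactly the type `t`.
        obtain ⟨N, X, u, hW, hf, hu, hun, hnull, hh⟩ := exists_countermodel hK hne hj e
          (fun i => D.bag_subset v (hemem i)) (some (unaryAtom {t}ᶜ i)) (by
            rintro _ ⟨⟩ hmem
            rw [unaryAtom_map, hi] at hmem
            exact hta.1 _ hmem rfl)
        have htu : typeOf θ.numFO N X (u i) = t := by
          by_contra hcon
          exact hh _ rfl (unaryAtom_mem_typeFacts.2 ⟨hu i, hcon⟩)
        refine ⟨N, X, u, hW, hf, hu, hun, ?_, ?_⟩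
        · rw [patternType_none N X (u i), ← hta.2, ← htu]
          rfl
        · intro i' a' ha' hi'
          obtain rfl := Sum.inl_injective ha'
          rw [heinj (hi'.trans hi.symm), htu]
      · obtain ⟨N, X, u, hW, hf, hu, hun, hnull, hh⟩ := exists_countermodel hK hne hj e
          (fun i => D.bag_subset v (hemem i)) (some (nullaryAtom θ _ {g₀}ᶜ)) (by
            rintro _ ⟨⟩ hmem
            rw [nullaryAtom_map] at hmem
            exact hg₀ _ hmem rfl)
        refine ⟨N, X, u, hW, hf, hu, hun, ?_, by simp⟩
        by_contra hcon
        refine hh _ rfl ?_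
        rw [nullaryAtom_map, nullaryAtom_mem_typeFacts]
        exact hcon
    obtain ⟨N, X, u, hW, hf, hu, hun, hnull, hh⟩ := hcounter
    let ι : Const → Const := Function.extend e u id
    have hι : ∀ i, ι (e i) = u i := fun i => heinj.extend_apply u id i
    refine ⟨fun a => typeOf θ.numFO N X (ι a), ⟨N, X, ι, hW, ?_, ?_, hnull⟩, ?_⟩
    · intro f hfO hfv
      obtain ⟨a, rfl⟩ := Atom.exists_map_eq (e := e) (f := f) (by rwa [he])
      rw [Atom.map_map, show ι ∘ e = u from funext hι]
      exact hf a hfO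
    · intro a ha
      rw [← he] at ha
      obtain ⟨i, rfl⟩ := ha
      simp only [hι]
      exact ⟨hu i, trivial, hun i⟩
    · intro a ha
      obtain ⟨i, hi⟩ := he.ge a.2
      dsimp only
      rw [← hi, hι]
      exact hh i a ha hi
  obtain ⟨ty, hty⟩ := D.exists_global hD L A
    (by
      rintro v f ⟨N, X, ι, -, -, hι, hnull⟩ a ha
      obtain ⟨-, h2, h3⟩ := hι a ha
      refine ⟨h3, ?_⟩
      rw [← hnull, ← h2, patternType_none N X (ι a)]
      rfl)
    (fun v => by
      obtain ⟨f, hf, -⟩ := hLocal v (Sum.inr ()) (∅, ∅) (by simp)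
      exact ⟨f, hf⟩)
    (fun v a ha t ht => by
      obtain ⟨f, hf, hfa⟩ := hLocal v (Sum.inl ⟨a, ha⟩) t (by
        rintro _ h
        obtain rfl := Sum.inl_injective h
        exact ht)
      exact ⟨f, hf, hfa _ rfl⟩)
  obtain ⟨s, hs⟩ := θ.exists_body_bound
  have := D.isTree.connected.nonempty
  refine MMSNP.holds_of_blocks (E := D.V) D.bag (fun v => {f ∈ O | f.vars ⊆ D.bag v})
    (fun f hf => ?_) (fun v f hf => hf.2) hs (D.hasLeaves hD s) ty g₀ ?_
  · obtain ⟨v, hv⟩ := D.covers f hf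
    exact ⟨v, hf, hv⟩
  · intro v
    obtain ⟨f, ⟨N, X, ι, hW, hf, hι, hnull⟩, hag⟩ := hty v
    exact ⟨N, X, ι, hW, fun f hf' => hf f hf'.1 hf'.2, fun a ha =>
      ⟨(hι a ha).1, (hι a ha).2.1.trans (hag a ha).symm⟩, hnull⟩

/-- Finite obstructions of treewidth `(1, k)` yield a monadic Datalog rewriting. -/
theorem MMSNP.negMDLogRewritable_of_obstructions {k : ℕ} (hempty : θ.Holds ∅)
    {Ω : Set (FactSet S)} (hΩ : θ.IsObstructionSet Ω)
    (hfin : ∀ O ∈ Ω, O.Finite ∧ HasTreewidth 1 k O) : θ.NegMDLogRewritable := by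
  refine ⟨canonicalProgram θ k, canonicalProgram_isMonadic k, fun I hI =>
    ⟨canonicalProgram_sound, fun h => ?_⟩⟩
  obtain ⟨O, hO, hOI⟩ := (hΩ I hI).1 h
  have hOθ : ¬ θ.Holds O := (hΩ O (hfin O hO).1).2 ⟨O, hO, HomTo.of_subset subset_rfl⟩
  exact (canonicalProgram_complete (hfin O hO).2 hempty hOθ).of_homTo hOI

end Canonical

/-! ### Voltage covers with large girth -/

section Voltage

variable {V E : Type} {k : ℕ}

open Classical in
/-- The voltage cover of a system of blocks over the vector space generated by the incidences. -/
noncomputable def liftVert (vt : E → Fin k → V) (e : E × (E × Fin k → ZMod 2)) (i : Fin k) :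
    V × (E × Fin k → ZMod 2) :=
  (vt e.1 i, e.2 + Pi.single (e.1, i) 1)

lemma liftVert_injective (vt : E → Fin k → V) (e : E × (E × Fin k → ZMod 2)) :
    Function.Injective (liftVert vt e) := by
  classical
  intro i j h
  have h2 : (Pi.single (e.1, i) 1 : E × Fin k → ZMod 2) = Pi.single (e.1, j) 1 := by
    simpa [liftVert] using congrArg Prod.snd h
  have h3 := congrFun h2 (e.1, i)
  by_contra hij
  rw [Pi.single_eq_same, Pi.single_eq_of_ne (by simpa using hij)] at h3
  exact one_ne_zero h3

/-- One more block is allowed per lift: a leafless family of `s + 1` blocks over distinct base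
blocks has too many incidences for their independent voltages. -/
lemma hasLeaves_liftVert [Finite V] [Finite E] {vt : E → Fin k → V}
    (hinj : ∀ e, Function.Injective (vt e)) {s : ℕ}
    (hC : HasLeaves (fun e => Set.range (vt e)) s) :
    HasLeaves (fun e => Set.range (liftVert vt e)) (s + 1) := by
  classical
  have := Fintype.ofFinite V
  have := Fintype.ofFinite E
  intro F hF hcard
  by_cases hs : (F.image Prod.fst).card ≤ s
  · obtain ⟨e, he, hsub⟩ := hC (F.image Prod.fst) (hF.image _) hs
    obtain ⟨f, hf, rfl⟩ := Finset.mem_image.1 he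
    refine ⟨f, hf, ?_⟩
    -- Distinct lifts of the same base block are disjoint, so shared vertices of `f` lie over shared
    -- vertices of its base block.
    have key : ∀ i, (∃ f' ∈ F, f' ≠ f ∧ liftVert vt f i ∈ Set.range (liftVert vt f')) →
        vt f.1 i ∈ {x ∈ Set.range (vt f.1) |
          ∃ e ∈ F.image Prod.fst, e ≠ f.1 ∧ x ∈ Set.range (vt e)} := by
      rintro i ⟨f', hf', hne, i', hi'⟩
      have h1 : vt f'.1 i' = vt f.1 i := congrArg Prod.fst hi'
      refine ⟨⟨i, rfl⟩, f'.1, Finset.mem_image_of_mem _ hf', ?_, i', h1⟩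
      intro hff
      apply hne
      have h2 : f'.2 + Pi.single (f'.1, i') 1 = f.2 + Pi.single (f.1, i) 1 :=
        congrArg Prod.snd hi'
      rw [hff] at h1 h2
      rw [hinj _ h1] at h2
      exact Prod.ext hff (add_right_cancel h2)
    rintro _ ⟨⟨i, rfl⟩, hi⟩ _ ⟨⟨j, rfl⟩, hj⟩
    rw [hinj _ (hsub (key i hi) (key j hj))]
  · by_contra hcon
    push Not at hcon
    have hFinj : Set.InjOn Prod.fst (F : Set (E × (E × Fin k → ZMod 2))) := by
      rw [← Finset.card_image_iff]
      have := Finset.card_image_le (s := F) (f := Prod.fst)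
      omega
    -- `W` consists of the shared vertices and `P` of their incidences. Without leaves, every block
    -- and every shared vertex has at least two incidences, so `P` has at least `F.card + W.card`
    -- elements.
    let W : Finset (V × (E × Fin k → ZMod 2)) := Finset.univ.filter fun x => ∃ f ∈ F, ∃ f' ∈ F, f' ≠ f ∧
      x ∈ Set.range (liftVert vt f) ∧ x ∈ Set.range (liftVert vt f')
    let P : Finset ((E × (E × Fin k → ZMod 2)) × Fin k) := (F ×ˢ Finset.univ).filter fun p =>
      liftVert vt p.1 p.2 ∈ W
    have hP1 : 2 * F.card ≤ P.card := by
      refine Finset.mul_card_image_le_card_of_maps_to (f := Prod.fst)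
        (fun p hp => (Finset.mem_product.1 (Finset.mem_filter.1 hp).1).1) 2 fun f hf => ?_
      obtain ⟨x, ⟨⟨i, rfl⟩, hi⟩, y, ⟨⟨j, rfl⟩, hj⟩, hxy⟩ := hcon f hf
      have hmem : ∀ i, (∃ f' ∈ F, f' ≠ f ∧ liftVert vt f i ∈ Set.range (liftVert vt f')) →
          (f, i) ∈ P.filter fun p => p.1 = f := by
        rintro i ⟨f', hf', hne, hi⟩
        simp only [P, W, Finset.mem_filter, Finset.mem_product, Finset.mem_univ, and_true, true_and]
        exact ⟨hf, f, hf, f', hf', hne, ⟨i, rfl⟩, hi⟩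
      exact Finset.one_lt_card.2 ⟨_, hmem i hi, _, hmem j hj, fun h =>
        hxy (congrArg (fun p : (E × (E × Fin k → ZMod 2)) × Fin k => liftVert vt f p.2) h)⟩
    have hP2 : 2 * W.card ≤ P.card := by
      refine Finset.mul_card_image_le_card_of_maps_to (s := P) (f := fun p => liftVert vt p.1 p.2)
        (fun p hp => (Finset.mem_filter.1 hp).2) 2 fun x hx => ?_
      obtain ⟨-, f, hf, f', hf', hne, ⟨i, hi⟩, ⟨i', hi'⟩⟩ := Finset.mem_filter.1 hx
      have hmem : ∀ g ∈ F, ∀ i, liftVert vt g i = x →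
          (g, i) ∈ P.filter fun p => liftVert vt p.1 p.2 = x := by
        intro g hg i hi
        simp only [P, Finset.mem_filter, Finset.mem_product, Finset.mem_univ, and_true, hi]
        exact ⟨hg, hx⟩
      exact Finset.one_lt_card.2 ⟨_, hmem f hf i hi, _, hmem f' hf' i' hi', fun h =>
        hne (congrArg Prod.fst h).symm⟩
    obtain ⟨f₀, hf₀⟩ := hF
    -- The voltage of an incidence is the difference of the group components of its vertex and its
    -- block. Normalizing by `f₀` saves one generator, so fewer than `P.card` vectors span `P.card`
    -- independent ones.
    let T : Finset (E × Fin k → ZMod 2) :=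
      (F.erase f₀).image (fun f => f.2 - f₀.2) ∪ W.image (fun x => x.2 - f₀.2)
    have hT : T.card ≤ (F.card - 1) + W.card := by
      refine (Finset.card_union_le _ _).trans (add_le_add ?_ Finset.card_image_le)
      exact Finset.card_image_le.trans (Finset.card_erase_of_mem hf₀).le
    have hTF : ∀ f ∈ F, f.2 - f₀.2 ∈ Submodule.span (ZMod 2) (T : Set (E × Fin k → ZMod 2)) := by
      intro f hf
      by_cases h : f = f₀
      · rw [h, sub_self]
        exact Submodule.zero_mem _
      · exact Submodule.subset_span (Finset.mem_coe.2 (Finset.mem_union_left _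
          (Finset.mem_image_of_mem _ (Finset.mem_erase.2 ⟨h, hf⟩))))
    have hTW : ∀ x ∈ W, x.2 - f₀.2 ∈ Submodule.span (ZMod 2) (T : Set (E × Fin k → ZMod 2)) :=
      fun x hx => Submodule.subset_span (Finset.mem_coe.2 (Finset.mem_union_right _
          (Finset.mem_image_of_mem _ hx)))
    have hli : LinearIndependent (ZMod 2) fun p : P =>
        (Pi.single (p.1.1.1, p.1.2) 1 : E × Fin k → ZMod 2) := by
      refine (Pi.linearIndependent_single_one (E × Fin k) (ZMod 2)).comp
        (fun p : P => (p.1.1.1, p.1.2)) ?_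
      rintro ⟨⟨f, i⟩, hp⟩ ⟨⟨f', i'⟩, hp'⟩ h
      simp only [Prod.mk.injEq] at h
      have h1 := hFinj (Finset.mem_product.1 (Finset.mem_filter.1 hp).1).1
        (Finset.mem_product.1 (Finset.mem_filter.1 hp').1).1 h.1
      simp only [Subtype.mk.injEq, Prod.mk.injEq]
      exact ⟨h1, h.2⟩
    have hle := linearIndependent_le_span' _ hli (T : Set (E × Fin k → ZMod 2)) (by
      rintro _ ⟨⟨⟨f, i⟩, hp⟩, rfl⟩
      obtain ⟨h1, h2⟩ := Finset.mem_filter.1 hp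
      have h3 := Submodule.sub_mem _ (hTW _ h2) (hTF f (Finset.mem_product.1 h1).1)
      have h4 : (liftVert vt f i).2 - f₀.2 - (f.2 - f₀.2) = Pi.single (f.1, i) 1 := by
        change f.2 + Pi.single (f.1, i) 1 - f₀.2 - (f.2 - f₀.2) = _
        abel
      dsimp only at h3
      rwa [h4] at h3)
    simp only [Cardinal.mk_fintype, Fintype.card_coe, Nat.cast_le, Finset.coe_sort_coe] at hle
    have : 0 < F.card := Finset.card_pos.2 ⟨f₀, hf₀⟩
    omega

end Voltage

/-- A finite system of blocks with vertices in the slots `Fin k`, where the blocks are copies of block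
types in `B`, vertices carry labels, and every vertex occurs in every slot of every type
that its label permits. -/
structure BlockCover (Λ B : Type) (k : ℕ) (lab : B → Fin k → Λ) where
  V : Type
  E : Type
  finite_V : Finite V
  finite_E : Finite E
  blockType : E → B
  label : V → Λ
  vert : E → Fin k → V
  label_vert : ∀ e i, label (vert e i) = lab (blockType e) i
  exists_slot : ∀ x b i, lab b i = label x → ∃ e, blockType e = b ∧ vert e i = x
  exists_block : ∀ b, ∃ e, blockType e = b

namespace BlockCover

variable {Λ B : Type} {k : ℕ} {lab : B → Fin k → Λ}

/-- The trivial cover: labels as vertices, block types as blocks. -/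
def base [Finite Λ] [Finite B] (lab : B → Fin k → Λ) : BlockCover Λ B k lab where
  V := Λ
  E := B
  finite_V := inferInstance
  finite_E := inferInstance
  blockType := id
  label := id
  vert := lab
  label_vert _ _ := rfl
  exists_slot _ b _ h := ⟨b, rfl, h⟩
  exists_block b := ⟨b, rfl⟩

/-- The voltage cover. -/
noncomputable def lift (C : BlockCover Λ B k lab) : BlockCover Λ B k lab where
  V := C.V × (C.E × Fin k → ZMod 2)
  E := C.E × (C.E × Fin k → ZMod 2)
  finite_V := by
    have := C.finite_V
    have := C.finite_E
    infer_instance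
  finite_E := by
    have := C.finite_E
    infer_instance
  blockType e := C.blockType e.1
  label x := C.label x.1
  vert := liftVert C.vert
  label_vert e i := C.label_vert e.1 i
  exists_slot x b i h := by
    classical
    obtain ⟨e, he, hx⟩ := C.exists_slot x.1 b i h
    exact ⟨(e, x.2 - Pi.single (e, i) 1), he, by simp [liftVert, hx]⟩
  exists_block b := by
    obtain ⟨e, he⟩ := C.exists_block b
    exact ⟨(e, 0), he⟩

/-- There are covers that are locally as tree-like as desired. -/
lemma exists_hasLeaves [Finite Λ] [Finite B] (lab : B → Fin k → Λ) (s : ℕ) :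
    ∃ C : BlockCover Λ B k lab, (∀ e, Function.Injective (C.vert e)) ∧
      HasLeaves (fun e => Set.range (C.vert e)) s := by
  induction s with
  | zero =>
    -- The leaf condition is vacuous here; the lift is only needed to separate the slots of a block.
    refine ⟨(base lab).lift, liftVert_injective _, fun F hF h => ?_⟩
    exact absurd h (Finset.card_pos.2 hF).not_ge
  | succ s ih =>
    obtain ⟨C, h1, h2⟩ := ih
    have := C.finite_V
    have := C.finite_E
    exact ⟨C.lift, liftVert_injective _, hasLeaves_liftVert h1 h2⟩

end BlockCover

lemma HasLeaves.image {E V W : Type} {inc : E → Set V} {s : ℕ} (h : HasLeaves inc s) {f : V → W}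
    (hf : Function.Injective f) : HasLeaves (fun e => f '' inc e) s := by
  intro F hF hs
  obtain ⟨e, he, hsub⟩ := h F hF hs
  refine ⟨e, he, ?_⟩
  rintro _ ⟨⟨x, hx, rfl⟩, e₁, he₁, hne₁, hx₁⟩ _ ⟨⟨y, hy, rfl⟩, e₂, he₂, hne₂, hy₂⟩
  rw [hf.mem_set_image] at hx₁ hy₂
  rw [hsub ⟨hx, e₁, he₁, hne₁, hx₁⟩ ⟨hy, e₂, he₂, hne₂, hy₂⟩]

/-! ### Folding infinite models, and finite obstructions -/

section Folding

variable {S : Schema} {θ : MMSNP S} {k : ℕ}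

/-- A model of `θ` of treewidth `(1, k)` can be folded into a finite model. -/
theorem MMSNP.exists_finite_folding {O : FactSet S} (hO : HasTreewidth 1 k O) (h : θ.Holds O) :
    ∃ M : FactSet S, M.Finite ∧ θ.Holds M ∧ HomTo O M := by
  classical
  by_cases hne : (adom O).Nonempty
  swap
  · refine ⟨O, (finite_setOf_vars_subset Set.finite_empty).subset fun f hf c hc => ?_, h,
      HomTo.of_subset subset_rfl⟩
    exact hne ⟨c, f, hf, hc⟩
  obtain ⟨a₀, ha₀⟩ := hne
  obtain ⟨X, hX⟩ := h.exists_witness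
  obtain ⟨D, h1, hsize⟩ := hO
  have hD : ∀ v w, v ≠ w → (D.bag v ∩ D.bag w).Subsingleton :=
    fun v w h => subsingleton_of_encard_le (h1 v w h)
  have hk : Nonempty (Fin k) := by
    obtain ⟨v, hv⟩ := D.exists_mem_bag ha₀
    obtain ⟨j, hj, e, -, he⟩ := exists_enumeration (hsize v)
    obtain ⟨i, -⟩ := he.ge hv
    exact ⟨⟨i, i.2.trans_le hj⟩⟩
  have henum : ∀ v, ∃ (u : Fin k → Const) (sec : Const → Fin k), (∀ i, u i ∈ adom O) ∧
      ∀ a ∈ D.bag v, u (sec a) = a := by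
    intro v
    obtain ⟨j, hj, e, -, he⟩ := exists_enumeration (hsize v)
    -- Bags with fewer than `k` constants are padded with `a₀`.
    let u : Fin k → Const := fun i => if hi : (i : ℕ) < j then e ⟨i, hi⟩ else a₀
    have hu : ∀ a ∈ D.bag v, ∃ i, u i = a := by
      intro a ha
      obtain ⟨i, rfl⟩ := he.ge ha
      exact ⟨⟨i, i.2.trans_le hj⟩, by simp [u]⟩
    choose! sec hsec using hu
    refine ⟨u, sec, fun i => ?_, hsec⟩
    dsimp only [u]
    split_ifs with hi
    · exact D.bag_subset v (he.le ⟨_, rfl⟩)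
    · exact ha₀
  choose u sec hu hsec using henum
  -- A block type describes a `k`-tuple over `O`: some atoms true of it and the types of its
  -- entries. There are finitely many.
  let B : Type := {b : Set (Atom S (Fin k)) × (Fin k → PType S θ.numSO θ.numFO) //
    ∃ u : Fin k → Const, (∀ i, u i ∈ adom O) ∧ (∀ a ∈ b.1, a.map u ∈ O) ∧
      ∀ i, typeOf θ.numFO O X (u i) = b.2 i}
  obtain ⟨s, hs⟩ := θ.exists_body_bound
  obtain ⟨C, hinj, hleaf⟩ := BlockCover.exists_hasLeaves (fun b : B => b.1.2) s
  have := C.finite_V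
  have := C.finite_E
  obtain ⟨j, hj⟩ := Countable.exists_injective_nat C.V
  let blkFacts : C.E → FactSet S := fun e =>
    {f | ∃ a ∈ (C.blockType e).1.1, a.map (j ∘ C.vert e) = f}
  have : Nonempty C.E :=
    ⟨(C.exists_block ⟨(∅, fun _ => typeOf θ.numFO O X a₀), fun _ => a₀, fun _ => ha₀, by simp,
      fun _ => rfl⟩).choose⟩
  refine ⟨⋃ e, blkFacts e, ?_, ?_, ?_⟩
  · refine Set.finite_iUnion fun e => ?_
    exact (Set.toFinite (C.blockType e).1.1).image fun a => a.map (j ∘ C.vert e)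
  · refine MMSNP.holds_of_blocks (fun e => j '' Set.range (C.vert e)) blkFacts
      (fun f hf => Set.mem_iUnion.1 hf) ?_ hs (hleaf.image hj)
      (Function.extend j C.label fun _ => (∅, ∅)) (patternType θ.numFO O X none) ?_
    · rintro e _ ⟨a, -, rfl⟩
      rw [Atom.vars_map, ← Set.range_comp]
      exact Set.image_subset_range _ _
    · intro e
      obtain ⟨w, hw1, hw2, hw3⟩ := (C.blockType e).2
      have hext : ∀ i, Function.extend (j ∘ C.vert e) w id (j (C.vert e i)) = w i :=
        fun i => (hj.comp (hinj e)).extend_apply w id i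
      refine ⟨O, X, Function.extend (j ∘ C.vert e) w id, hX, ?_, ?_, rfl⟩
      · rintro _ ⟨a, ha, rfl⟩
        rw [Atom.map_map, show Function.extend (j ∘ C.vert e) w id ∘ (j ∘ C.vert e) = w from
          funext hext]
        exact hw2 a ha
      · rintro _ ⟨_, ⟨i, rfl⟩, rfl⟩
        rw [hext, hj.extend_apply, C.label_vert]
        exact ⟨hw1 i, hw3 i⟩
  · let b : D.V → B := fun v =>
      ⟨({a | a.map (u v) ∈ O}, fun i => typeOf θ.numFO O X (u v i)), u v, hu v, fun a ha => ha,
        fun _ => rfl⟩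
    -- Each bag goes to a block of its own description. A vertex with the right label occurs in the
    -- required slot of such a block, so one prescribed value always extends.
    obtain ⟨h, hh⟩ := D.exists_global hD
      (fun v => {f | ∃ e, C.blockType e = b v ∧ ∀ a ∈ D.bag v, f a = j (C.vert e (sec v a))})
      (fun a => {x | ∃ y, j y = x ∧ C.label y = typeOf θ.numFO O X a})
      (by
        rintro v f ⟨e, he, hf⟩ a ha
        refine ⟨_, (hf a ha).symm, ?_⟩
        rw [C.label_vert, he]
        change typeOf θ.numFO O X (u v (sec v a)) = _
        rw [hsec v a ha])
      (fun v => by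
        obtain ⟨e, he⟩ := C.exists_block (b v)
        exact ⟨fun a => j (C.vert e (sec v a)), e, he, fun _ _ => rfl⟩)
      (by
        rintro v a ha _ ⟨y, rfl, hy⟩
        obtain ⟨e, he, hey⟩ := C.exists_slot y (b v) (sec v a) (by
          change typeOf θ.numFO O X (u v (sec v a)) = _
          rw [hsec v a ha, hy])
        exact ⟨fun a => j (C.vert e (sec v a)), ⟨e, he, fun _ _ => rfl⟩, congrArg j hey⟩)
    refine ⟨h, fun f hf => ?_⟩
    obtain ⟨v, hv⟩ := D.covers f hf
    obtain ⟨t, ⟨e, he, ht⟩, hag⟩ := hh v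
    refine Set.mem_iUnion.2 ⟨e, f.map (sec v), ?_, ?_⟩
    · rw [he]
      change (f.map (sec v)).map (u v) ∈ O
      rw [Atom.map_map, Atom.map_eq_self (f := u v ∘ sec v) fun x hx => hsec v x (hv hx)]
      exact hf
    · rw [Atom.map_map]
      exact Atom.map_congr fun x hx => ((hag x (hv hx)).trans (ht x (hv hx))).symm

/-- Infinite obstructions of treewidth `(1, k)` can be replaced by finite ones. -/
theorem MMSNP.exists_finite_obstructions {Ω : Set (FactSet S)} (hΩ : θ.IsObstructionSet Ω)
    (htw : ∀ O ∈ Ω, HasTreewidth 1 k O) :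
    ∃ Ω : Set (FactSet S), θ.IsObstructionSet Ω ∧ ∀ O ∈ Ω, O.Finite ∧ HasTreewidth 1 k O := by
  refine ⟨{O | O.Finite ∧ HasTreewidth 1 k O ∧ ¬ θ.Holds O}, fun I hI => ⟨fun h => ?_, ?_⟩,
    fun O hO => ⟨hO.1, hO.2.1⟩⟩
  · obtain ⟨O, hO, hOI⟩ := (hΩ I hI).1 h
    -- The obstruction property speaks of finite instances only; an infinite member satisfying `θ`
    -- would map to a finite model.
    have hOθ : ¬ θ.Holds O := by
      intro hOθ
      obtain ⟨M, hM, hMθ, hOM⟩ := MMSNP.exists_finite_folding (htw O hO) hOθ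
      exact (hΩ M hM).2 ⟨O, hO, hOM⟩ hMθ
    have : ¬ ∀ O' ⊆ O, O'.Finite → θ.Holds O' := fun h => hOθ (MMSNP.holds_of_finite_subsets h)
    push Not at this
    obtain ⟨O', hsub, hfin, hO'⟩ := this
    exact ⟨O', ⟨hfin, (htw O hO).subset hsub, hO'⟩, (HomTo.of_subset hsub).trans hOI⟩
  · rintro ⟨O, ⟨-, -, hO⟩, hOI⟩ h
    exact hO (h.of_homTo hOI)

end Folding

/-! ### Sparse Ramsey hypergraphs by partite amalgamation -/

/-- Every nonempty set of at most `s` members of the family `inc` has a member that meets the union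
of the others and of a given root in at most one element. -/
def HasRootedLeaves {E V : Type} (inc : E → Set V) (s : ℕ) : Prop :=
  ∀ F : Finset E, F.Nonempty → F.card ≤ s → ∀ R : Set V, R.Subsingleton →
    ∃ e ∈ F, {x ∈ inc e | x ∈ R ∨ ∃ f ∈ F, f ≠ e ∧ x ∈ inc f}.Subsingleton

section Amalgam

variable {V E A VX EX : Type} (part : V → A) (a : A) (emb : EX → {v // part v = a} → VX)

open Classical in
/-- The copy of `V` indexed by `e`, in which the part `a` is identified with the edge `e` of another
hypergraph. -/
noncomputable def amalgamMap (e : EX) (v : V) : (V × EX) ⊕ VX :=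
  if h : part v = a then Sum.inr (emb e ⟨v, h⟩) else Sum.inl (v, e)

variable {part a emb}

lemma amalgamMap_of_eq {e : EX} {v : V} (h : part v = a) :
    amalgamMap part a emb e v = Sum.inr (emb e ⟨v, h⟩) := dif_pos h

lemma amalgamMap_of_ne {e : EX} {v : V} (h : part v ≠ a) :
    amalgamMap part a emb e v = Sum.inl (v, e) := dif_neg h

lemma amalgamMap_injective (hemb : ∀ e, Function.Injective (emb e)) (e : EX) :
    Function.Injective (amalgamMap part a emb e) := by
  intro v w h
  by_cases hv : part v = a <;> by_cases hw : part w = a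
  · rw [amalgamMap_of_eq hv, amalgamMap_of_eq hw] at h
    exact congrArg Subtype.val (hemb e (Sum.inr_injective h))
  · rw [amalgamMap_of_eq hv, amalgamMap_of_ne hw] at h
    exact absurd h Sum.inr_ne_inl
  · rw [amalgamMap_of_ne hv, amalgamMap_of_eq hw] at h
    exact absurd h Sum.inl_ne_inr
  · rw [amalgamMap_of_ne hv, amalgamMap_of_ne hw] at h
    exact congrArg Prod.fst (Sum.inl_injective h)

lemma part_eq_of_amalgamMap_eq {e e' : EX} {v v' : V} (hne : e' ≠ e)
    (h : amalgamMap part a emb e' v' = amalgamMap part a emb e v) :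
    ∃ hv : part v = a, emb e ⟨v, hv⟩ ∈ Set.range (emb e') := by
  by_cases hv : part v = a <;> by_cases hw : part v' = a
  · rw [amalgamMap_of_eq hv, amalgamMap_of_eq hw] at h
    exact ⟨hv, _, Sum.inr_injective h⟩
  · rw [amalgamMap_of_eq hv, amalgamMap_of_ne hw] at h
    exact absurd h Sum.inl_ne_inr
  · rw [amalgamMap_of_ne hv, amalgamMap_of_eq hw] at h
    exact absurd h Sum.inr_ne_inl
  · rw [amalgamMap_of_ne hv, amalgamMap_of_ne hw] at h
    exact absurd (congrArg Prod.snd (Sum.inl_injective h)) hne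

/-- Sparsity `s` of the outer hypergraph suffices for `s + 1` edges: an edge alone in its copy meets
other copies only in part `a`, hence at most once, and otherwise fewer copies than edges are
involved. Roots are needed because the contact of a copy with the rest acts as a root inside it. -/
lemma hasRootedLeaves_amalgam {inc : E → Set V} {s : ℕ} (hinc : HasRootedLeaves inc (s + 1))
    (hpart : ∀ e, Set.InjOn part (inc e)) (hemb : ∀ e, Function.Injective (emb e))
    (hX : HasRootedLeaves (fun e => Set.range (emb e)) s) :
    HasRootedLeaves (fun p : E × EX => amalgamMap part a emb p.2 '' inc p.1) (s + 1) := by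
  classical
  intro F hF hcard R hR
  have hinj := amalgamMap_injective (part := part) (a := a) hemb
  set κ := amalgamMap part a emb with hκ
  have core : ∀ e ∈ F.image Prod.snd,
      {v | κ e v ∈ R ∨ ∃ p ∈ F, p.2 ≠ e ∧ κ e v ∈ κ p.2 '' inc p.1}.Subsingleton →
      ∃ p ∈ F, {x ∈ κ p.2 '' inc p.1 | x ∈ R ∨ ∃ q ∈ F, q ≠ p ∧ x ∈ κ q.2 '' inc q.1}.Subsingleton
      := by
    intro e he hN
    obtain ⟨p₀, hp₀, rfl⟩ := Finset.mem_image.1 he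
    obtain ⟨f, hf, hsub⟩ := hinc ((F.filter fun p => p.2 = p₀.2).image Prod.fst)
      ⟨p₀.1, Finset.mem_image_of_mem _ (Finset.mem_filter.2 ⟨hp₀, rfl⟩)⟩
      ((Finset.card_image_le.trans (Finset.card_filter_le _ _)).trans hcard) _ hN
    obtain ⟨p, hp, rfl⟩ := Finset.mem_image.1 hf
    obtain ⟨hpF, hpe⟩ := Finset.mem_filter.1 hp
    refine ⟨p, hpF, ?_⟩
    have key : ∀ v ∈ inc p.1, (κ p.2 v ∈ R ∨ ∃ q ∈ F, q ≠ p ∧ κ p.2 v ∈ κ q.2 '' inc q.1) →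
        v ∈ {x ∈ inc p.1 | x ∈ {v | κ p₀.2 v ∈ R ∨ ∃ p ∈ F, p.2 ≠ p₀.2 ∧ κ p₀.2 v ∈ κ p.2 '' inc p.1} ∨
          ∃ f ∈ (F.filter fun p => p.2 = p₀.2).image Prod.fst, f ≠ p.1 ∧ x ∈ inc f} := by
      rintro v hv (h | ⟨q, hq, hqp, h⟩)
      · exact ⟨hv, Or.inl (Or.inl (hpe ▸ h))⟩
      · by_cases hqe : q.2 = p₀.2
        · refine ⟨hv, Or.inr ⟨q.1, Finset.mem_image_of_mem _ (Finset.mem_filter.2 ⟨hq, hqe⟩), ?_, ?_⟩⟩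
          · exact fun h => hqp (Prod.ext h (hqe.trans hpe.symm))
          · rwa [hqe, hpe, (hinj p₀.2).mem_set_image] at h
        · exact ⟨hv, Or.inl (Or.inr ⟨q, hq, hqe, hpe ▸ h⟩)⟩
    rintro _ ⟨⟨v, hv, rfl⟩, hv'⟩ _ ⟨⟨w, hw, rfl⟩, hw'⟩
    rw [hsub (key v hv hv') (key w hw hw')]
  by_cases h1 : ∀ p ∈ F, ∀ q ∈ F, p.2 = q.2
  · obtain ⟨p, hp⟩ := hF
    refine core p.2 (Finset.mem_image_of_mem _ hp) ?_
    rintro v (hv | ⟨q, hq, hne, -⟩) w (hw | ⟨q', hq', hne', -⟩)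
    · exact hinj _ (hR hv hw)
    · exact absurd (h1 q' hq' p hp) hne'
    · exact absurd (h1 q hq p hp) hne
    · exact absurd (h1 q hq p hp) hne
  -- The root is a private vertex of this copy; at most one copy is of this kind.
  let Rt : EX → Prop := fun e => ∃ v, Sum.inl (v, e) ∈ R
  have hRt : ∀ e e', Rt e → Rt e' → e = e' := by
    rintro e e' ⟨v, hv⟩ ⟨v', hv'⟩
    exact congrArg Prod.snd (Sum.inl_injective (hR hv hv'))
  have hnotRt : ∀ e v, ¬ Rt e → κ e v ∈ R → ∃ hv : part v = a, Sum.inr (emb e ⟨v, hv⟩) ∈ R := by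
    intro e v he hv
    by_cases h : part v = a
    · rw [hκ, amalgamMap_of_eq h] at hv
      exact ⟨h, hv⟩
    · rw [hκ, amalgamMap_of_ne h] at hv
      exact absurd ⟨v, hv⟩ he
  by_cases h2 : ∃ p ∈ F, ¬ Rt p.2 ∧ ∀ q ∈ F, q.2 = p.2 → q = p
  · obtain ⟨p, hp, hpR, hpu⟩ := h2
    refine ⟨p, hp, ?_⟩
    have key : ∀ v, (κ p.2 v ∈ R ∨ ∃ q ∈ F, q ≠ p ∧ κ p.2 v ∈ κ q.2 '' inc q.1) → part v = a := by
      rintro v (h | ⟨q, hq, hqp, w, -, h⟩)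
      · exact (hnotRt _ _ hpR h).1
      · exact (part_eq_of_amalgamMap_eq (fun h => hqp (hpu q hq h)) h).1
    rintro _ ⟨⟨v, hv, rfl⟩, hv'⟩ _ ⟨⟨w, hw, rfl⟩, hw'⟩
    rw [hpart p.1 hv hw ((key v hv').trans (key w hw').symm)]
  have hnonroot : ∃ p ∈ F, ¬ Rt p.2 := by
    by_contra hcon
    push Not at hcon
    exact h1 fun p hp q hq => hRt _ _ (hcon p hp) (hcon q hq)
  have hcard' : (F.image Prod.snd).card ≤ s := by
    obtain ⟨p, hp, hpR⟩ := hnonroot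
    have hlt : (F.image Prod.snd).card < F.card := by
      refine lt_of_le_of_ne Finset.card_image_le fun heq => h2 ⟨p, hp, hpR, fun q hq hqp => ?_⟩
      exact Finset.card_image_iff.1 heq hq hp hqp
    omega
  have hfind : ∃ e ∈ F.image Prod.snd, ¬ Rt e ∧ {y ∈ Set.range (emb e) | Sum.inr y ∈ R ∨
      ∃ e' ∈ F.image Prod.snd, e' ≠ e ∧ y ∈ Set.range (emb e')}.Subsingleton := by
    obtain ⟨e, he, hsub⟩ := hX _ (hF.image Prod.snd) hcard' {y | Sum.inr y ∈ R}
      fun x hx y hy => Sum.inr_injective (hR hx hy)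
    -- If the leaf copy contains the private root, delete it and make its single point of contact
    -- the root; the next leaf copy is free of the old root.
    by_cases heR : Rt e
    · obtain ⟨p, hp, hpR⟩ := hnonroot
      have hpe : p.2 ≠ e := fun h => hpR (h ▸ heR)
      obtain ⟨e₂, he₂, hsub₂⟩ := hX ((F.image Prod.snd).erase e)
        ⟨p.2, Finset.mem_erase.2 ⟨hpe, Finset.mem_image_of_mem _ hp⟩⟩
        ((Finset.card_erase_le).trans hcard')
        {y ∈ Set.range (emb e) | ∃ e' ∈ F.image Prod.snd, e' ≠ e ∧ y ∈ Set.range (emb e')}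
        (hsub.anti fun y hy => ⟨hy.1, Or.inr hy.2⟩)
      obtain ⟨hne, he₂F⟩ := Finset.mem_erase.1 he₂
      refine ⟨e₂, he₂F, fun h => hne (hRt _ _ h heR), hsub₂.anti ?_⟩
      rintro y ⟨hy, h | ⟨e', he', hne', hy'⟩⟩
      · obtain ⟨v, hv⟩ := heR
        exact absurd (hR h hv) Sum.inr_ne_inl
      · refine ⟨hy, ?_⟩
        by_cases hee : e' = e
        · subst hee
          exact Or.inl ⟨hy', e₂, he₂F, hne, hy⟩
        · exact Or.inr ⟨e', Finset.mem_erase.2 ⟨hee, he'⟩, hne', hy'⟩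
    · exact ⟨e, he, heR, hsub⟩
  obtain ⟨e, he, heR, hsub⟩ := hfind
  refine core e he ?_
  have key : ∀ v, (κ e v ∈ R ∨ ∃ p ∈ F, p.2 ≠ e ∧ κ e v ∈ κ p.2 '' inc p.1) →
      ∃ hv : part v = a, emb e ⟨v, hv⟩ ∈ {y ∈ Set.range (emb e) | Sum.inr y ∈ R ∨
        ∃ e' ∈ F.image Prod.snd, e' ≠ e ∧ y ∈ Set.range (emb e')} := by
    rintro v (h | ⟨p, hp, hpe, w, -, h⟩)
    · obtain ⟨hv, h⟩ := hnotRt e v heR h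
      exact ⟨hv, ⟨_, rfl⟩, Or.inl h⟩
    · obtain ⟨hv, h⟩ := part_eq_of_amalgamMap_eq hpe h
      exact ⟨hv, ⟨_, rfl⟩, Or.inr ⟨p.2, Finset.mem_image_of_mem _ hp, hpe, h⟩⟩
  intro v hv w hw
  obtain ⟨h3, h4⟩ := key v hv
  obtain ⟨h5, h6⟩ := key w hw
  exact congrArg Subtype.val (hemb e (hsub h4 h6))

end Amalgam

/-- A finite hypergraph whose vertices are partitioned into parts such that every edge meets every
part at most once. -/
structure PartiteHypergraph (A : Type) where
  V : Type
  E : Type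
  finite_V : Finite V
  finite_E : Finite E
  part : V → A
  inc : E → Set V
  injOn : ∀ e, Set.InjOn part (inc e)

/-- A copy of one partite hypergraph in another. -/
structure PartiteHypergraph.Copy {A : Type} (P Q : PartiteHypergraph A) where
  onV : P.V → Q.V
  onE : P.E → Q.E
  part_onV : ∀ x, Q.part (onV x) = P.part x
  inc_onE : ∀ e, Q.inc (onE e) = onV '' P.inc e

/-- There are hypergraphs with edges of size `M` in which every coloring has a
monochromatic edge and in which any `s` edges have rooted leaves. -/
def HasMonochromatic (s : ℕ) : Prop :=
  ∀ (M C : Type) [Finite M] [Finite C] [Nonempty C], ∃ (V E : Type) (emb : E → M → V),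
    Finite V ∧ Finite E ∧ (∀ e, Function.Injective (emb e)) ∧
      HasRootedLeaves (fun e => Set.range (emb e)) s ∧
      ∀ χ : V → C, ∃ e, ∀ m m', χ (emb e m) = χ (emb e m')

/-- Parts are made monochromatic one at a time: amalgamate copies of `Q` along a hypergraph whose
edges are copies of part `a`. A monochromatic edge selects a copy of `Q`, inside which the earlier
parts are treated. -/
lemma exists_ramsey_of_hasMonochromatic {s : ℕ} (hs : HasMonochromatic s) {A : Type}
    (C : Type) [Finite C] [Nonempty C] (P : PartiteHypergraph A)
    (hP : HasRootedLeaves P.inc (s + 1)) (B : Finset A) :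
    ∃ Q : PartiteHypergraph A, HasRootedLeaves Q.inc (s + 1) ∧ ∀ χ : Q.V → C,
      ∃ φ : P.Copy Q, ∀ x y, P.part x = P.part y → P.part x ∈ B → χ (φ.onV x) = χ (φ.onV y) := by
  classical
  induction B using Finset.induction_on with
  | empty => exact ⟨P, hP, fun χ => ⟨⟨id, id, fun _ => rfl, fun _ => by simp⟩, by simp⟩⟩
  | insert a B _ ih =>
    obtain ⟨Q, hQ, hχ⟩ := ih
    have := Q.finite_V
    have := Q.finite_E
    obtain ⟨VX, EX, emb, _, _, hemb, hleaf, hmono⟩ := hs {v // Q.part v = a} C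
    let part' : (Q.V × EX) ⊕ VX → A := Sum.elim (fun p => Q.part p.1) (fun _ => a)
    have hpart' : ∀ e v, part' (amalgamMap Q.part a emb e v) = Q.part v := by
      intro e v
      by_cases h : Q.part v = a
      · rw [amalgamMap_of_eq h]
        exact h.symm
      · rw [amalgamMap_of_ne h]
        rfl
    refine ⟨⟨(Q.V × EX) ⊕ VX, Q.E × EX, inferInstance, inferInstance, part',
      fun p => amalgamMap Q.part a emb p.2 '' Q.inc p.1, ?_⟩,
      hasRootedLeaves_amalgam hQ Q.injOn hemb hleaf, fun χ => ?_⟩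
    · rintro p _ ⟨v, hv, rfl⟩ _ ⟨w, hw, rfl⟩ h
      rw [hpart', hpart'] at h
      rw [Q.injOn p.1 hv hw h]
    · obtain ⟨e, he⟩ := hmono fun y => χ (Sum.inr y)
      obtain ⟨φ, hφ⟩ := hχ fun v => χ (amalgamMap Q.part a emb e v)
      refine ⟨⟨amalgamMap Q.part a emb e ∘ φ.onV, fun f => (φ.onE f, e), fun x => ?_, fun f => ?_⟩,
        fun x y hxy hx => ?_⟩
      · exact (hpart' _ _).trans (φ.part_onV x)
      · change amalgamMap Q.part a emb e '' Q.inc (φ.onE f) = _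
        rw [φ.inc_onE, Set.image_comp]
      · rcases Finset.mem_insert.1 hx with hxa | hxB
        · have h1 : Q.part (φ.onV x) = a := (φ.part_onV x).trans hxa
          have h2 : Q.part (φ.onV y) = a := (φ.part_onV y).trans (hxy.symm.trans hxa)
          change χ (amalgamMap Q.part a emb e (φ.onV x)) = χ (amalgamMap Q.part a emb e (φ.onV y))
          rw [amalgamMap_of_eq h1, amalgamMap_of_eq h2]
          exact he _ _
        · exact hφ x y hxy hxB

/-- By pigeonhole some color class has at least as many elements as `M`. -/
lemma exists_monochromatic_embedding {M C : Type} [Finite M] [Finite C] [Nonempty C]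
    (c : M × C → C) : ∃ g : M ↪ M × C, ∀ m m', c (g m) = c (g m') := by
  classical
  have := Fintype.ofFinite M
  have := Fintype.ofFinite C
  obtain ⟨y, hy⟩ := Fintype.exists_le_card_fiber_of_mul_le_card c (n := Fintype.card M)
    (by rw [Fintype.card_prod, mul_comm])
  rw [← Fintype.card_subtype] at hy
  obtain ⟨g⟩ := Function.Embedding.nonempty_of_card_le hy
  exact ⟨g.trans (Function.Embedding.subtype _), fun m m' => (g m).2.trans (g m').2.symm⟩

/-- Pairwise disjoint edges have rooted leaves. -/
lemma hasRootedLeaves_of_disjoint {E V : Type} {inc : E → Set V}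
    (h : ∀ e f x, x ∈ inc e → x ∈ inc f → e = f) (s : ℕ) : HasRootedLeaves inc s := by
  intro F hF _ R hR
  obtain ⟨e, he⟩ := hF
  refine ⟨e, he, hR.anti ?_⟩
  rintro x ⟨hx, hxR | ⟨f, -, hne, hxf⟩⟩
  · exact hxR
  · exact absurd (h f e x hxf hx) hne

/-- Apply the Ramsey statement to disjoint edges, one for each embedding of `M` into the set `M × C`
of parts. In a copy whose coloring depends only on the part, the edge of a monochromatic embedding
is monochromatic. -/
lemma hasMonochromatic (s : ℕ) : HasMonochromatic s := by
  classical
  induction s with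
  | zero =>
    intro M C _ _ _
    refine ⟨M × C, M ↪ M × C, fun g => g, inferInstance, inferInstance, fun g => g.injective, ?_,
      exists_monochromatic_embedding⟩
    intro F hF h
    exact absurd h (Finset.card_pos.2 hF).not_ge
  | succ s ih =>
    intro M C _ _ _
    have := Fintype.ofFinite M
    have := Fintype.ofFinite C
    let P : PartiteHypergraph (M × C) :=
      { V := (M ↪ M × C) × M
        E := M ↪ M × C
        finite_V := inferInstance
        finite_E := inferInstance
        part := fun x => x.1 x.2
        inc := fun g => {x | x.1 = g}
        injOn := by
          rintro g ⟨_, m⟩ rfl ⟨_, m'⟩ rfl h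
          exact Prod.ext rfl (Function.Embedding.injective _ h) }
    obtain ⟨Q, hQ, hχ⟩ := exists_ramsey_of_hasMonochromatic ih C P
      (hasRootedLeaves_of_disjoint (by rintro e f x rfl rfl; rfl) _) Finset.univ
    have := Q.finite_V
    have := Q.finite_E
    -- Keep the edges of `Q` that `M` can enumerate; the choice of enumeration does not affect
    -- monochromaticity.
    let EX : Type := {e : Q.E // ∃ emb : M → Q.V, Function.Injective emb ∧ Set.range emb = Q.inc e}
    refine ⟨Q.V, EX, fun e => e.2.choose, inferInstance, inferInstance,
      fun e => e.2.choose_spec.1, ?_, fun χ => ?_⟩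
    · intro F hF hcard R hR
      obtain ⟨e, he, hsub⟩ := hQ (F.map (Function.Embedding.subtype _)) (hF.map)
        (by rwa [Finset.card_map]) R hR
      obtain ⟨e, heF, rfl⟩ := Finset.mem_map.1 he
      refine ⟨e, heF, hsub.anti ?_⟩
      rintro x ⟨hx, hx'⟩
      refine ⟨e.2.choose_spec.2 ▸ hx, hx'.imp_right ?_⟩
      rintro ⟨f, hf, hne, hxf⟩
      exact ⟨f.1, Finset.mem_map_of_mem _ hf, fun h => hne (Subtype.ext h),
        f.2.choose_spec.2 ▸ hxf⟩
    · obtain ⟨φ, hφ⟩ := hχ χ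
      let c : M × C → C := fun α =>
        if h : ∃ x, P.part x = α then χ (φ.onV h.choose) else Classical.arbitrary C
      have hc : ∀ x, χ (φ.onV x) = c (P.part x) := by
        intro x
        have h : ∃ y, P.part y = P.part x := ⟨x, rfl⟩
        simp only [c, dif_pos h]
        exact hφ _ _ h.choose_spec.symm (Finset.mem_univ _)
      obtain ⟨g, hg⟩ := exists_monochromatic_embedding c
      have hrange : Set.range (fun m => φ.onV (g, m)) = Q.inc (φ.onE g) := by
        rw [φ.inc_onE]
        ext y
        constructor
        · rintro ⟨m, rfl⟩
          exact ⟨(g, m), rfl, rfl⟩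
        · rintro ⟨⟨_, m⟩, rfl, rfl⟩
          exact ⟨m, rfl⟩
      have hinj : Function.Injective fun m => φ.onV (g, m) := by
        intro m m' h
        have := congrArg Q.part h
        rw [φ.part_onV, φ.part_onV] at this
        exact g.injective this
      let e : EX := ⟨φ.onE g, _, hinj, hrange⟩
      have key : ∀ m, ∃ m', χ (e.2.choose m) = c (g m') := by
        intro m
        obtain ⟨m', hm'⟩ := hrange.ge (e.2.choose_spec.2.le ⟨m, rfl⟩)
        exact ⟨m', by rw [← hm', hc]⟩
      refine ⟨e, fun m m' => ?_⟩
      obtain ⟨m₁, h₁⟩ := key m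
      obtain ⟨m₂, h₂⟩ := key m'
      rw [h₁, h₂, hg m₁ m₂]

/-- For every locally tree-like partite hypergraph `P` there is a locally tree-like partite
hypergraph such that every coloring of its vertices is constant on the parts of some copy of
`P`. -/
theorem exists_ramsey {A : Type} [Finite A] (C : Type) [Finite C] [Nonempty C] {s : ℕ}
    (P : PartiteHypergraph A) (hP : HasRootedLeaves P.inc (s + 1)) :
    ∃ Q : PartiteHypergraph A, HasRootedLeaves Q.inc (s + 1) ∧ ∀ χ : Q.V → C,
      ∃ φ : P.Copy Q, ∀ x y, P.part x = P.part y → χ (φ.onV x) = χ (φ.onV y) := by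
  have := Fintype.ofFinite A
  obtain ⟨Q, hQ, hχ⟩ := exists_ramsey_of_hasMonochromatic (hasMonochromatic s) C P hP Finset.univ
  refine ⟨Q, hQ, fun χ => ?_⟩
  obtain ⟨φ, hφ⟩ := hχ χ
  exact ⟨φ, fun x y h => hφ x y h (Finset.mem_univ _)⟩

/-! ### Sparse falsifying preimages -/

section Sparse

variable {S : Schema} {k : ℕ}

lemma HasRootedLeaves.hasLeaves {E V : Type} {inc : E → Set V} {s : ℕ}
    (h : HasRootedLeaves inc s) : HasLeaves inc s := by
  intro F hF hs
  obtain ⟨e, he, hsub⟩ := h F hF hs ∅ Set.subsingleton_empty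
  exact ⟨e, he, hsub.anti fun x hx => ⟨hx.1, Or.inr hx.2⟩⟩

lemma adom_setOf_vars_subset (A : Set Const) : adom {f : Atom S Const | f.vars ⊆ A} ⊆ A := by
  rintro c ⟨f, hf, hc⟩
  exact hf hc

lemma hasTreewidth_of_hasLeaves {E : Type} {inc : E → Set Const} {s : ℕ} (h : HasLeaves inc s)
    (F : Finset E) (hs : F.card ≤ s) (hk : ∀ e ∈ F, (inc e).encard ≤ k) :
    HasTreewidth 1 k {f : Atom S Const | ∃ e ∈ F, f.vars ⊆ inc e} := by
  classical
  induction hn : F.card generalizing F with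
  | zero =>
    rw [Finset.card_eq_zero] at hn
    subst hn
    refine HasTreewidth.of_adom_subset (A := ∅) (by simp) ?_
    rintro c ⟨f, ⟨e, he, -⟩, -⟩
    simp at he
  | succ n ih =>
    obtain ⟨e, he, hsub⟩ := h F (Finset.card_pos.1 (by omega)) hs
    have hcard : (F.erase e).card = n := by rw [Finset.card_erase_of_mem he]; omega
    have h1 := ih (F.erase e) (by omega) (fun f hf => hk f (Finset.mem_of_mem_erase hf)) hcard
    have h2 : HasTreewidth 1 k {f : Atom S Const | f.vars ⊆ inc e} :=
      HasTreewidth.of_adom_subset (hk e he) (adom_setOf_vars_subset _)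
    refine (h1.union h2 (hsub.anti ?_)).subset ?_
    · rintro c ⟨⟨f, ⟨e', he', hf⟩, hc⟩, hc'⟩
      exact ⟨adom_setOf_vars_subset _ hc', e', Finset.mem_of_mem_erase he',
        Finset.ne_of_mem_erase he', hf hc⟩
    · rintro f ⟨e', he', hf⟩
      by_cases hee : e' = e
      · exact Or.inr (hee ▸ hf)
      · exact Or.inl ⟨e', Finset.mem_erase.2 ⟨hee, he'⟩, hf⟩

/-- An instance that falsifies `θ` has a locally tree-like homomorphic preimage that falsifies
`θ`. -/
theorem MMSNP.exists_sparse {θ : MMSNP S} {I : FactSet S} (hI : I.Finite)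
    (hsmall : ∀ f ∈ I, f.vars.ncard ≤ θ.diameter) (hθ : ¬ θ.Holds I) (s : ℕ) :
    ∃ J : FactSet S, HomTo J I ∧ J.Finite ∧ ¬ θ.Holds J ∧
      ∀ J' ⊆ J, J'.Finite → J'.ncard ≤ s → HasTreewidth 1 θ.diameter J' := by
  classical
  set k := θ.diameter with hk
  let A : Type := {a // a ∈ adom I}
  have : Finite A := (adom_finite hI).to_subtype
  have := Fintype.ofFinite A
  -- One disjoint edge for each set of at most `k` constants, the parts being the constants.
  -- Vertices with second component outside the set are isolated; they make the positions below
  -- total.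
  let P : PartiteHypergraph A :=
    { V := {B : Finset A // B.card ≤ k} × A
      E := {B : Finset A // B.card ≤ k}
      finite_V := inferInstance
      finite_E := inferInstance
      part := Prod.snd
      inc := fun B => {x | x.1 = B ∧ x.2 ∈ B.1}
      injOn := by
        rintro B ⟨_, a⟩ ⟨rfl, -⟩ ⟨_, a'⟩ ⟨h, -⟩ (rfl : a = a')
        exact Prod.ext h.symm rfl }
  obtain ⟨Q, hQ, hχ⟩ := exists_ramsey (Set (Fin θ.numSO)) (s := s) P
    (hasRootedLeaves_of_disjoint (by rintro e f x ⟨rfl, -⟩ ⟨rfl, -⟩; rfl) _)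
  have := Q.finite_V
  obtain ⟨j, hj⟩ := Countable.exists_injective_nat Q.V
  let J : FactSet S := {f | ∃ (a : Atom S Q.V) (e : Q.E), (Q.inc e).encard ≤ k ∧
    a.vars ⊆ Q.inc e ∧ a.map (fun x => (Q.part x).1) ∈ I ∧ a.map j = f}
  refine ⟨J, ?_, ?_, ?_, ?_⟩
  · refine ⟨Function.extend j (fun x => (Q.part x).1) id, ?_⟩
    rintro _ ⟨a, e, -, -, ha, rfl⟩
    rw [Atom.map_map, show Function.extend j (fun x => (Q.part x).1) id ∘ j = _ from
      funext fun x => hj.extend_apply _ _ x]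
    exact ha
  · refine (Set.finite_range fun a : Atom S Q.V => a.map j).subset ?_
    rintro _ ⟨a, e, -, -, -, rfl⟩
    exact ⟨a, rfl⟩
  · intro hJ
    apply hθ
    obtain ⟨X, hX⟩ := hJ.exists_witness
    obtain ⟨φ, hφ⟩ := hχ fun x => color X (j x)
    let pos : P.E → Const → Const := fun B c =>
      if h : c ∈ adom I then j (φ.onV (B, ⟨c, h⟩)) else 0
    have hpos : ∀ B (α : A), pos B α.1 = j (φ.onV (B, α)) := fun B α => dif_pos α.2
    have hcol : ∀ c ∈ adom I, ∀ B B' i, pos B c ∈ X i → pos B' c ∈ X i := by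
      intro c hc B B' i h
      rw [hpos B ⟨c, hc⟩] at h
      rw [hpos B' ⟨c, hc⟩]
      have : color X (j (φ.onV (B, ⟨c, hc⟩))) = color X (j (φ.onV (B', ⟨c, hc⟩))) := hφ _ _ rfl
      exact this.le h
    have hfact : ∀ (B : P.E), ∀ f ∈ I, (∀ α : A, α.1 ∈ f.vars → α ∈ B.1) → f.map (pos B) ∈ J := by
      intro B f hf hB
      obtain ⟨a, rfl⟩ := Atom.exists_map_eq (e := (Subtype.val : A → Const)) (f := f) (by
        rw [Subtype.range_val]
        exact fun c hc => ⟨f, hf, hc⟩)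
      refine ⟨a.map fun α => φ.onV (B, α), φ.onE B, ?_, ?_, ?_, ?_⟩
      · rw [φ.inc_onE]
        refine (Set.encard_image_le _ _).trans ?_
        have : P.inc B ⊆ (fun α => (B, α)) '' (B.1 : Set A) := by
          rintro ⟨_, α⟩ ⟨rfl, hα⟩
          exact ⟨α, hα, rfl⟩
        refine (Set.encard_le_encard this).trans ((Set.encard_image_le _ _).trans ?_)
        rw [Set.encard_coe_eq_coe_finsetCard]
        exact_mod_cast B.2
      · rw [Atom.vars_map, φ.inc_onE]
        rintro _ ⟨α, hα, rfl⟩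
        exact ⟨(B, α), ⟨rfl, hB α (by rw [Atom.vars_map]; exact ⟨α, hα, rfl⟩)⟩, rfl⟩
      · rw [Atom.map_map, show (fun x => (Q.part x).1) ∘ (fun α => φ.onV (B, α)) = Subtype.val from
          funext fun α => congrArg Subtype.val (φ.part_onV (B, α))]
        exact hf
      · rw [Atom.map_map, Atom.map_map]
        exact congrArg (fun g => a.map g) (funext fun α => (hpos B α).symm)
    have hfree : ∀ c ∈ adom I, ∃ B : P.E, pos B c ∈ adom J := by
      rintro c ⟨f, hf, hc⟩
      have hcard : (Finset.univ.filter fun α : A => α.1 ∈ f.vars).card ≤ k := by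
        refine le_trans ?_ (hsmall f hf)
        rw [← Set.ncard_coe_finset, ← Set.ncard_image_of_injective _ Subtype.val_injective]
        refine Set.ncard_le_ncard ?_ f.finite_vars
        rintro _ ⟨α, hα, rfl⟩
        exact (Finset.mem_filter.1 (Finset.mem_coe.1 hα)).2
      let B : P.E := ⟨_, hcard⟩
      refine ⟨B, _, hfact B f hf (fun α hα => Finset.mem_filter.2 ⟨Finset.mem_univ _, hα⟩), ?_⟩
      rw [Atom.vars_map]
      exact ⟨c, hc, rfl⟩
    have : Nonempty P.E := ⟨⟨∅, Nat.zero_le _⟩⟩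
    choose! Bf hBf using hfree
    refine MMSNP.Witness.holds (X := fun i => {c | ∃ B, pos B c ∈ X i}) ?_
    intro c hc v hv hSO hE
    have hcard : (Finset.univ.filter fun α : A => ∃ x ∈ c.vars, v x = α.1).card ≤ k := by
      refine le_trans ?_ (MMSNP.ncard_vars_le_diameter hc)
      rw [← Set.ncard_coe_finset, ← Set.ncard_image_of_injective _ Subtype.val_injective]
      refine (Set.ncard_le_ncard ?_ ((Set.toFinite c.vars).image v)).trans
        (Set.ncard_image_le (Set.toFinite _))
      rintro _ ⟨α, hα, rfl⟩
      exact (Finset.mem_filter.1 (Finset.mem_coe.1 hα)).2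
    let B : P.E := ⟨_, hcard⟩
    -- The values of the clause variables form a set of size at most `k`, so all body facts fit into
    -- its edge. Variables in no relational body atom could leave the active domain there and are
    -- placed in the edge of some fact instead; colors depend only on the part.
    let v' : Fin θ.numFO → Const := fun x =>
      if ∃ a ∈ c.bodyEDB, x ∈ a.vars then pos B (v x) else pos (Bf (v x)) (v x)
    have hv'E : ∀ a ∈ c.bodyEDB, a.map v' ∈ J := by
      intro a ha
      have h1 := hfact B (a.map v) (hE a ha) (by
        intro α hα
        rw [Atom.vars_map] at hα
        obtain ⟨x, hx, hxα⟩ := hα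
        simp only [B, Finset.mem_filter, Finset.mem_univ, true_and]
        exact ⟨x, Implication.vars_of_bodyEDB ha hx, hxα⟩)
      rw [Atom.map_map] at h1
      rwa [Atom.map_congr (g := pos B ∘ v)]
      intro x hx
      exact if_pos ⟨a, ha, hx⟩
    have hv'pos : ∀ x, ∃ B, v' x = pos B (v x) := by
      intro x
      by_cases h : ∃ a ∈ c.bodyEDB, x ∈ a.vars
      · exact ⟨B, if_pos h⟩
      · exact ⟨Bf (v x), if_neg h⟩
    have hv'X : ∀ x ∈ c.vars, ∀ i, v' x ∈ X i ↔ ∃ B, pos B (v x) ∈ X i := by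
      intro x hx i
      obtain ⟨B', hB'⟩ := hv'pos x
      constructor
      · intro h
        exact ⟨B', hB' ▸ h⟩
      · rintro ⟨B'', h⟩
        rw [hB']
        exact hcol _ (hv x hx) _ _ _ h
    obtain ⟨p, hp, hp'⟩ := hX c hc v' (fun x hx => by
      by_cases h : ∃ a ∈ c.bodyEDB, x ∈ a.vars
      · obtain ⟨a, ha, hxa⟩ := h
        exact ⟨_, hv'E a ha, by rw [Atom.vars_map]; exact ⟨x, hxa, rfl⟩⟩
      · rw [show v' x = pos (Bf (v x)) (v x) from if_neg h]
        exact hBf _ (hv x hx))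
      (fun p hp => (hv'X _ (Implication.vars_of_bodySO hp) _).2 (hSO p hp)) hv'E
    exact ⟨p, hp, (hv'X _ (Implication.vars_of_head hp) _).1 hp'⟩
  · intro J' hJ' hfin hcard
    have hedge : ∀ f ∈ J', ∃ e, (Q.inc e).encard ≤ k ∧ f.vars ⊆ j '' Q.inc e := by
      intro f hf
      obtain ⟨a, e, he, ha, -, rfl⟩ := hJ' hf
      exact ⟨e, he, by rw [Atom.vars_map]; exact Set.image_mono ha⟩
    have hedge' : ∀ f : J', ∃ e, (Q.inc e).encard ≤ k ∧ f.1.vars ⊆ j '' Q.inc e :=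
      fun f => hedge f f.2
    choose e he1 he2 using hedge'
    have := hfin.fintype
    refine (hasTreewidth_of_hasLeaves (hQ.hasLeaves.image hj) (Finset.univ.image e) ?_ ?_).subset
      (I := J') (k := k) ?_
    · refine Finset.card_image_le.trans ?_
      rw [Finset.card_univ, ← Nat.card_eq_fintype_card, Nat.card_coe_set_eq]
      omega
    · intro e' he'
      obtain ⟨f, -, rfl⟩ := Finset.mem_image.1 he'
      exact (Set.encard_image_le _ _).trans (he1 f)
    · intro f hf
      exact ⟨e ⟨f, hf⟩, Finset.mem_image_of_mem _ (Finset.mem_univ _), he2 ⟨f, hf⟩⟩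

end Sparse

/-! ### Unfolding monadic derivations into trees -/

section Derivations

variable {S : Schema} {Γ : DatalogProgram S}

/-- The program derives the intensional fact `f` on `D`. -/
def DatalogProgram.Derives (Γ : DatalogProgram S) (D : FactSet S) (f : Atom Γ.idb Const) : Prop :=
  ∀ (K : FactSet Γ.idb) (g : Prop), (∀ r ∈ Γ.rules, r.Sat D K g) → f ∈ K

lemma DatalogProgram.Derives.map {D D' : FactSet S} {f : Atom Γ.idb Const} (h : Γ.Derives D f)
    {σ : Const → Const} (hσ : ∀ f ∈ D, f.map σ ∈ D') : Γ.Derives D' (f.map σ) :=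
  fun _ _ hK => h _ _ fun r hr => (hK r hr).preimage hσ

lemma DatalogProgram.Derives.mono {D D' : FactSet S} {f : Atom Γ.idb Const} (h : Γ.Derives D f)
    (hD : D ⊆ D') : Γ.Derives D' f :=
  h.map (σ := id) fun _ hf => hD hf

lemma DatalogProgram.IsMonadic.subsingleton_vars (hΓ : Γ.IsMonadic) {α : Type}
    (f : Atom Γ.idb α) : f.vars.Subsingleton := by
  rintro _ ⟨i, rfl⟩ _ ⟨i', rfl⟩
  have h := hΓ f.sym
  have : i = i' := Fin.ext (by omega)
  rw [this]

/-- The intensional facts over `J` that are derived on a finite preimage of treewidth `(1, k)`. -/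
def treeDerivable (Γ : DatalogProgram S) (k : ℕ) (J : FactSet S) : FactSet Γ.idb :=
  {f | ∃ (D : FactSet S) (h : Const → Const) (f' : Atom Γ.idb Const), D.Finite ∧
    HasTreewidth 1 k D ∧ (∀ a ∈ D, a.map h ∈ J) ∧ Γ.Derives D f' ∧ f'.map h = f}

/-- Tree-like preimages for several intensional facts can be glued to a given one. -/
lemma exists_glued_preimage (hΓ : Γ.IsMonadic) {k n : ℕ} {J D₀ : FactSet S} (hD₀ : D₀.Finite)
    (htw : HasTreewidth 1 k D₀) (hJ : D₀ ⊆ J) (v : Fin n → Const)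
    (l : List (Atom Γ.idb (Fin n))) (hl : ∀ b ∈ l, b.map v ∈ treeDerivable Γ k J) :
    ∃ (D : FactSet S) (h : Const → Const), D₀ ⊆ D ∧ D.Finite ∧ HasTreewidth 1 k D ∧
      (∀ a ∈ D, a.map h ∈ J) ∧ (∀ x, h (v x) = v x) ∧ ∀ b ∈ l, Γ.Derives D (b.map v) := by
  classical
  induction l with
  | nil => exact ⟨D₀, id, subset_rfl, hD₀, htw, hJ, fun _ => rfl, by simp⟩
  | cons b l ih =>
    obtain ⟨D, h, hsub, hfin, hDtw, hh, hv, hder⟩ := ih fun b hb => hl b (List.mem_cons_of_mem _ hb)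
    obtain ⟨D', h', f', hfin', htw', hh', hder', hf'⟩ := hl b List.mem_cons_self
    obtain ⟨N, hN⟩ := ((adom_finite hfin).union (Set.finite_range v)).bddAbove
    have hN1 : ∀ c ∈ adom D, c < N + 1 := fun c hc => Nat.lt_succ_of_le (hN (Or.inl hc))
    have hN2 : ∀ x, v x < N + 1 := fun x => Nat.lt_succ_of_le (hN (Or.inr ⟨x, rfl⟩))
    -- Rename `D'` apart from `D` and `v`, except for the constant of `f'`, of which there is at
    -- most one because the program is monadic.
    let σ : Const → Const := fun c => if c ∈ f'.vars then h' c else c + (N + 1)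
    have hσ1 : ∀ c ∈ f'.vars, σ c = h' c := fun c hc => if_pos hc
    have hσ2 : ∀ c, c ∉ f'.vars → σ c = c + (N + 1) := fun c hc => if_neg hc
    have hrange : ∀ c ∈ f'.vars, ∃ x, h' c = v x := by
      intro c hc
      have : h' c ∈ (f'.map h').vars := by
        rw [Atom.vars_map]
        exact ⟨c, hc, rfl⟩
      rw [hf', Atom.vars_map] at this
      obtain ⟨x, -, hx⟩ := this
      exact ⟨x, hx.symm⟩
    have hσlt : ∀ c ∈ f'.vars, σ c < N + 1 := by
      intro c hc
      obtain ⟨x, hx⟩ := hrange c hc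
      rw [hσ1 c hc, hx]
      exact hN2 x
    have hσinj : Function.Injective σ := by
      intro c c' hcc
      by_cases hc : c ∈ f'.vars <;> by_cases hc' : c' ∈ f'.vars
      · exact hΓ.subsingleton_vars f' hc hc'
      · have := hσlt c hc
        rw [hcc, hσ2 c' hc'] at this
        exact absurd this (Nat.not_lt.2 (Nat.le_add_left _ _))
      · have := hσlt c' hc'
        rw [← hcc, hσ2 c hc] at this
        exact absurd this (Nat.not_lt.2 (Nat.le_add_left _ _))
      · rw [hσ2 c hc, hσ2 c' hc'] at hcc
        exact Nat.add_right_cancel hcc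
    let h'' : Const → Const := fun c => if c < N + 1 then h c else h' (c - (N + 1))
    have h''1 : ∀ c, c < N + 1 → h'' c = h c := fun c hc => if_pos hc
    have h''σ : ∀ c, h'' (σ c) = h' c := by
      intro c
      by_cases hc : c ∈ f'.vars
      · obtain ⟨x, hx⟩ := hrange c hc
        rw [h''1 _ (hσlt c hc), hσ1 c hc, hx, hv]
      · rw [hσ2 c hc]
        exact (if_neg (Nat.not_lt.2 (Nat.le_add_left _ _))).trans
          (congrArg h' (Nat.add_sub_cancel (n := c) (m := N + 1)))
    have himg : ∀ f ∈ D', f.map σ ∈ D ∪ Atom.map σ '' D' := fun f hf => Or.inr ⟨f, hf, rfl⟩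
    refine ⟨D ∪ Atom.map σ '' D', h'', hsub.trans Set.subset_union_left,
      hfin.union (hfin'.image _), hDtw.union (htw'.image hσinj) ?_, ?_, ?_, ?_⟩
    · have hshared : ∀ c ∈ adom D, c ∈ adom (Atom.map σ '' D') → ∃ y ∈ f'.vars, σ y = c := by
        rintro c hc ⟨_, ⟨f, hf, rfl⟩, hcf⟩
        rw [Atom.vars_map] at hcf
        obtain ⟨y, hy, rfl⟩ := hcf
        refine ⟨y, ?_, rfl⟩
        by_contra hyf
        have := hN1 _ hc
        rw [hσ2 y hyf] at this
        exact Nat.not_lt.2 (Nat.le_add_left _ _) this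
      rintro c ⟨hc1, hc2⟩ d ⟨hd1, hd2⟩
      obtain ⟨y, hy, rfl⟩ := hshared c hc1 hc2
      obtain ⟨z, hz, rfl⟩ := hshared d hd1 hd2
      rw [hΓ.subsingleton_vars f' hy hz]
    · rintro _ (ha | ⟨a, ha, rfl⟩)
      · rw [Atom.map_congr fun c hc => h''1 c (hN1 c ⟨_, ha, hc⟩)]
        exact hh _ ha
      · rw [Atom.map_map, show h'' ∘ σ = h' from funext h''σ]
        exact hh' a ha
    · intro x
      rw [h''1 _ (hN2 x), hv]
    · intro b' hb'
      rcases List.mem_cons.1 hb' with rfl | hb'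
      · rw [← hf', ← Atom.map_congr hσ1]
        exact hder'.map himg
      · exact (hder b' hb').mono Set.subset_union_left

/-- A program that holds in a locally tree-like instance holds in a finite preimage of
treewidth `(1, k)`. -/
theorem DatalogProgram.Holds.exists_tree_preimage (hΓ : Γ.IsMonadic) {k s : ℕ} {J : FactSet S}
    (hs : ∀ r ∈ Γ.rules, r.bodyEDB.length ≤ s)
    (hJ : ∀ J' ⊆ J, J'.Finite → J'.ncard ≤ s → HasTreewidth 1 k J') (hhold : Γ.Holds J) :
    ∃ D : FactSet S, D.Finite ∧ HasTreewidth 1 k D ∧ HomTo D J ∧ Γ.Holds D := by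
  classical
  -- Interpret the goal as the desired conclusion itself and check that tree-derivable facts are
  -- closed under all rules. Only the number of body atoms has to be bounded, so rules may have more
  -- than `k` variables.
  refine hhold (treeDerivable Γ k J) _ fun r hr v hE hI => ?_
  let D₀ : FactSet S := ((r.bodyEDB.map fun a => a.map v).toFinset : Set (Atom S Const))
  have hD₀ : D₀ ⊆ J := by
    intro f hf
    simp only [D₀, List.coe_toFinset, List.mem_map] at hf
    obtain ⟨a, ha, rfl⟩ := hf
    exact hE a ha
  have hcard : D₀.ncard ≤ s := by
    rw [Set.ncard_coe_finset]
    refine (List.toFinset_card_le _).trans ?_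
    rw [List.length_map]
    exact hs r hr
  obtain ⟨D, h, hsub, hfin, htw, hh, hv, hder⟩ := exists_glued_preimage hΓ (Finset.finite_toSet _)
    (hJ D₀ hD₀ (Finset.finite_toSet _) hcard) hD₀ v r.bodyIDB hI
  have hED : ∀ a ∈ r.bodyEDB, a.map v ∈ D := by
    intro a ha
    refine hsub ?_
    simp only [List.coe_toFinset, List.mem_map]
    exact ⟨a, ha, rfl⟩
  have hfire := fun (K : FactSet Γ.idb) (g : Prop) (hK : ∀ r ∈ Γ.rules, r.Sat D K g) =>
    hK r hr v hED fun b hb => hder b hb K g hK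
  cases hhead : r.head with
  | none =>
    simp only [hhead] at hfire
    exact ⟨D, hfin, htw, ⟨h, hh⟩, hfire⟩
  | some b =>
    simp only [hhead] at hfire
    refine ⟨D, h, b.map v, hfin, htw, hh, hfire, ?_⟩
    rw [Atom.map_map]
    exact Atom.map_congr fun x _ => hv x

/-- A monadic Datalog rewriting yields finite obstructions of treewidth `(1, k)`. -/
theorem MMSNP.NegMDLogRewritable.exists_finite_obstructions {θ : MMSNP S}
    (hθ : θ.NegMDLogRewritable)
    (harity : (∃ R, θ.diameter < S.arity R) →
      ∀ N : FactSet S, adom N = ∅ → θ.Holds N →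
        ∃ I : FactSet S, I.Finite ∧ N ⊆ I ∧ (adom I).Nonempty ∧ θ.Holds I) :
    ∃ Ω : Set (FactSet S), θ.IsObstructionSet Ω ∧
      ∀ O ∈ Ω, O.Finite ∧ HasTreewidth 1 θ.diameter O := by
  obtain ⟨Γ, hΓ, hrew⟩ := hθ
  obtain ⟨s, hs⟩ := (((List.finite_toSet Γ.rules).image fun r => r.bodyEDB.length)).bddAbove
  refine ⟨{O | O.Finite ∧ HasTreewidth 1 θ.diameter O ∧ ¬ θ.Holds O},
    fun I hI => ⟨fun h => ?_, ?_⟩, fun O hO => ⟨hO.1, hO.2.1⟩⟩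
  · have hsmall : ¬ θ.Holds {f ∈ I | f.vars.ncard ≤ θ.diameter} :=
      fun h' => h (MMSNP.holds_of_small_facts harity h')
    have hsub : {f ∈ I | f.vars.ncard ≤ θ.diameter} ⊆ I := Set.sep_subset _ _
    obtain ⟨J, hJI, hJfin, hJθ, hJ⟩ := MMSNP.exists_sparse (hI.subset hsub) (fun f hf => hf.2)
      hsmall s
    obtain ⟨D, hfin, htw, hDJ, hD⟩ := DatalogProgram.Holds.exists_tree_preimage hΓ
      (fun r hr => hs ⟨r, hr, rfl⟩) hJ ((hrew J hJfin).2 hJθ)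
    exact ⟨D, ⟨hfin, htw, (hrew D hfin).1 hD⟩, (hDJ.trans hJI).trans (HomTo.of_subset hsub)⟩
  · rintro ⟨O, ⟨-, -, hO⟩, hOI⟩ h
    exact hO (h.of_homTo hOI)

end Derivations

end MDLogObstruction

theorem mainTheorem7 (S : Schema) (θ : MMSNP S) (k : ℕ) (hk : θ.diameter = k)
    (hempty : θ.Holds ∅)
    (harity : (∃ R, k < S.arity R) →
      ∀ N : FactSet S, adom N = ∅ → θ.Holds N →
        ∃ I : FactSet S, I.Finite ∧ N ⊆ I ∧ (adom I).Nonempty ∧ θ.Holds I) :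
    (θ.NegMDLogRewritable ↔
      ∃ Ω : Set (FactSet S), θ.IsObstructionSet Ω ∧ ∀ O ∈ Ω, HasTreewidth 1 k O) ∧
    ((∃ Ω : Set (FactSet S), θ.IsObstructionSet Ω ∧ ∀ O ∈ Ω, HasTreewidth 1 k O) ↔
      ∃ Ω : Set (FactSet S), θ.IsObstructionSet Ω ∧
        ∀ O ∈ Ω, O.Finite ∧ HasTreewidth 1 k O) := by
  subst hk
  have h32 : (∃ Ω : Set (FactSet S), θ.IsObstructionSet Ω ∧
        ∀ O ∈ Ω, O.Finite ∧ HasTreewidth 1 θ.diameter O) →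
      ∃ Ω : Set (FactSet S), θ.IsObstructionSet Ω ∧ ∀ O ∈ Ω, HasTreewidth 1 θ.diameter O :=
    fun ⟨Ω, hΩ, h⟩ => ⟨Ω, hΩ, fun O hO => (h O hO).2⟩
  have h23 : (∃ Ω : Set (FactSet S), θ.IsObstructionSet Ω ∧
        ∀ O ∈ Ω, HasTreewidth 1 θ.diameter O) →
      ∃ Ω : Set (FactSet S), θ.IsObstructionSet Ω ∧
        ∀ O ∈ Ω, O.Finite ∧ HasTreewidth 1 θ.diameter O :=
    fun ⟨_, hΩ, h⟩ => MMSNP.exists_finite_obstructions hΩ h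
  refine ⟨⟨fun h => h32 (h.exists_finite_obstructions harity), fun h => ?_⟩, h23, h32⟩
  obtain ⟨Ω, hΩ, hfin⟩ := h23 h
  exact MMSNP.negMDLogRewritable_of_obstructions hempty hΩ hfin
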